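/- Let $b$ and $w$ be positive integers, let $\pi$ be a probability distribution on the non-negative integers with mean $0<\mu\le\infty$, and let $\tau\sim\pi$. Consider the following Pólya urn with immigration. Let $\tau_1,\tau_2,\dots$ be i.i.d. with law $\pi$ and let $T_j=\sum_{i=1}^j\tau_i$. Initially the urn holds $b$ black and $w$ white balls. At each step a uniformly chosen ball is drawn and returned along with another ball of the same colour. Additionally, after draw $n$ (before the first draw, if $n=0$), and regardless of the outcomes of the draws, one extra black ball is added for every $j\ge 1$ with $T_j=n$. Let $\mathrm{UL}(n,\pi,b,w)$ denote the law of the number of white balls in the urn after $n$ draws, and interpret $\frac{\mu}{\mu+1}$ as $1$ if $\mu=\infty$. Let $k$ be an integer such that either (a) $\mathbb{E}\,\tau^p<\infty$ for some real $p>1$ with $1\le k<\left(\frac p2-1\right)(\mu+1)-1$, or (b) $k\ge 1$ and there are $\varepsilon>0$ and $C>0$ such that $\mathbb{P}[\tau>n]\ge C n^{-(1-\varepsilon)}$ for all sufficiently large integers $n$. Then there is a constant $m_k(b,w,\pi)>0$, depending only on $k$, $b$, $w$ and $\pi$, such that for $X_n\sim\mathrm{UL}(n,\pi,b,w)$ we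 have $$\mathbb{E}\left[\left(\frac{X_n}{n^{\mu/(\mu+1)}}\right)^k\right]\longrightarrow m_k(b,w,\pi)\qquad\text{as } n\to\infty .$$ -/

import Mathlib

open MeasureTheory ProbabilityTheory Filter Topology
open scoped ENNReal

noncomputable section

namespace ImmigrationUrn

/-- The arrival time `T_j = τ_1 + ⋯ + τ_j`; the entry `τ i` of the sequence is `τ_{i+1}`. -/
def arrivalTime (τ : ℕ → ℕ) (j : ℕ) : ℕ := ∑ i ∈ Finset.range j, τ i

/-- The number of `j ≥ 1` with `T_j = n`: the number of black balls that immigrate right after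
draw `n` (before the first draw, for `n = 0`). The set is finite for almost every sequence of
i.i.d. inter-arrival times that are not identically zero. -/
def arrivals (τ : ℕ → ℕ) (n : ℕ) : ℕ := {j : ℕ | 1 ≤ j ∧ arrivalTime τ j = n}.ncard

/-- The law of the contents (white, black) after one classical Pólya draw from an urn with
contents `s`: a uniformly chosen ball is returned along with another one of the same colour. -/
def draw (s : ℕ × ℕ) : Measure (ℕ × ℕ) :=
  ((s.1 : ℝ≥0∞) / (s.1 + s.2)) • Measure.dirac (s.1 + 1, s.2) +
    ((s.2 : ℝ≥0∞) / (s.1 + s.2)) • Measure.dirac (s.1, s.2 + 1)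

/-- The conditional law, given the inter-arrival times `τ`, of the contents (white, black) of the
urn after `n` draws and the immigrations following them, starting from `b` black and `w` white
balls. -/
def contents (b w : ℕ) (τ : ℕ → ℕ) : ℕ → Measure (ℕ × ℕ)
  | 0 => Measure.dirac (w, b + arrivals τ 0)
  | n + 1 => (contents b w τ n).bind fun s =>
      (draw s).map fun s' => (s'.1, s'.2 + arrivals τ (n + 1))

/-- The law of the number of white balls after `n` draws, in the Pólya urn with immigration of
black balls at random times whose inter-arrival times are i.i.d. with law `π`, started from
`b` black and `w` white balls. -/
def urnLaw (n : ℕ) (π : Measure ℕ) (b w : ℕ) : Measure ℕ :=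
  (Measure.infinitePi fun _ : ℕ => π).bind fun τ => (contents b w τ n).map Prod.fst

/-- The mean of `π`, possibly infinite. -/
def mean (π : Measure ℕ) : ℝ≥0∞ := ∫⁻ j, (j : ℝ≥0∞) ∂π

/-- The exponent `μ / (μ + 1)`, read as `1` for `μ = ∞`. -/
def exponent (μ : ℝ≥0∞) : ℝ := if μ = ∞ then 1 else μ.toReal / (μ.toReal + 1)

theorem measurable_arrivalTime (j : ℕ) : Measurable fun τ : ℕ → ℕ => arrivalTime τ j := by
  unfold arrivalTime
  fun_prop

theorem measurable_arrivals (n : ℕ) : Measurable fun τ : ℕ → ℕ => arrivals τ n := by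
  have h : ∀ τ : ℕ → ℕ, arrivals τ n = ⌊(∑' j : ℕ,
      {τ : ℕ → ℕ | 1 ≤ j ∧ arrivalTime τ j = n}.indicator (1 : (ℕ → ℕ) → ℝ≥0∞) τ).toReal⌋₊ := by
    intro τ
    have h1 : (∑' j : ℕ,
        {τ : ℕ → ℕ | 1 ≤ j ∧ arrivalTime τ j = n}.indicator (1 : (ℕ → ℕ) → ℝ≥0∞) τ) =
        Measure.count {j : ℕ | 1 ≤ j ∧ arrivalTime τ j = n} := by
      rw [← lintegral_indicator_one (.of_discrete), lintegral_count]
      rfl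
    rw [h1, Measure.count_apply .of_discrete, arrivals, Set.ncard]
    cases h2 : ({j : ℕ | 1 ≤ j ∧ arrivalTime τ j = n} : Set ℕ).encard using ENat.recTopCoe with
    | top => simp
    | coe a => simp
  simp_rw [h]
  refine Nat.measurable_floor.comp (Measurable.ennreal_toReal (Measurable.tsum fun j => ?_))
  refine measurable_one.indicator ?_
  by_cases hj : 1 ≤ j
  · simp only [hj, true_and]
    exact measurable_arrivalTime j (measurableSet_singleton n)
  · simp [hj]

theorem measurable_contents (b w n : ℕ) : Measurable fun τ : ℕ → ℕ => contents b w τ n := by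
  induction n with
  | zero =>
    exact Measure.measurable_dirac.comp
      ((measurable_of_countable fun a : ℕ => (w, b + a)).comp (measurable_arrivals 0))
  | succ n ih =>
    refine Measure.measurable_of_measurable_coe _ fun s hs => ?_
    have h : ∀ τ : ℕ → ℕ, contents b w τ (n + 1) s = ∑' p : ℕ × ℕ,
        ((draw p).map fun s' => (s'.1, s'.2 + arrivals τ (n + 1))) s * contents b w τ n {p} := by
      intro τ
      rw [contents, Measure.bind_apply hs (measurable_of_countable _).aemeasurable,
        lintegral_countable']
    simp_rw [h]
    refine Measurable.tsum fun p => Measurable.mul ?_ ?_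
    · exact (measurable_of_countable fun a : ℕ =>
        ((draw p).map fun s' => (s'.1, s'.2 + a)) s).comp (measurable_arrivals (n + 1))
    · exact (Measure.measurable_coe (measurableSet_singleton p)).comp ih

theorem isProbabilityMeasure_contents {b w : ℕ} (hw : 0 < w) (τ : ℕ → ℕ) (n : ℕ) :
    IsProbabilityMeasure (contents b w τ n) ∧ ∀ᵐ s ∂contents b w τ n, 0 < s.1 := by
  induction n with
  | zero =>
    refine ⟨Measure.dirac.isProbabilityMeasure, ?_⟩
    rw [contents, ae_dirac_eq]
    exact hw
  | succ n ih =>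
    obtain ⟨ih1, ih2⟩ := ih
    have hd : ∀ s : ℕ × ℕ, 0 < s.1 → draw s Set.univ = 1 := by
      intro s hs
      simp only [draw, Measure.add_apply, Measure.smul_apply, measure_univ, smul_eq_mul, mul_one]
      rw [← ENNReal.add_div]
      exact ENNReal.div_self (by positivity) (by finiteness)
    constructor
    · constructor
      rw [contents, Measure.bind_apply .univ (measurable_of_countable _).aemeasurable]
      rw [lintegral_congr_ae (g := fun _ => 1)]
      · simp
      · filter_upwards [ih2] with s hs
        rw [Measure.map_apply (measurable_of_countable _) .univ]
        exact hd s hs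
    · rw [contents, ae_iff,
        Measure.bind_apply .of_discrete (measurable_of_countable _).aemeasurable,
        lintegral_congr_ae (g := fun _ => 0)]
      · simp
      · filter_upwards [ih2] with s hs
        rw [Measure.map_apply (measurable_of_countable _) .of_discrete]
        simp [draw, hs.ne']

theorem isProbabilityMeasure_urnLaw (n : ℕ) (π : Measure ℕ) [IsProbabilityMeasure π] (b : ℕ)
    {w : ℕ} (hw : 0 < w) : IsProbabilityMeasure (urnLaw n π b w) := by
  constructor
  have hm : Measurable fun τ : ℕ → ℕ => (contents b w τ n).map Prod.fst :=
    (Measure.measurable_map _ measurable_fst).comp (measurable_contents b w n)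
  rw [urnLaw, Measure.bind_apply .univ hm.aemeasurable]
  have h : ∀ τ : ℕ → ℕ, ((contents b w τ n).map Prod.fst) Set.univ = 1 := fun τ => by
    have := (isProbabilityMeasure_contents (b := b) hw τ n).1
    rw [Measure.map_apply measurable_fst .univ, Set.preimage_univ, measure_univ]
  simp [h]

end ImmigrationUrn

end

/-! Condition on the inter-arrival times. The urn size after `i` draws is then the deterministic
number N_i = b + w + i + R_i, with R_i the number of immigrants, and only the colours are random.
The next draw multiplies the conditional mean of the k-th rising factorial of the white count by 1 +
k/N_i. The rising factorial moment is therefore a constant times the mean over τ of ∏_{i<n} (1 +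
k/N_i) (`integrable_ascFactorial_urnLaw`), and powers differ from rising factorials by terms of
lower order.

Put α = μ/(μ+1). If the errors |1/N_i - α/(i+1)| are summable, the product divided by n^(kα) tends
to a positive limit (`exists_tendsto_prod_div_rpow`). Dominated convergence carries this over to the
mean (`exists_tendsto_integral_prod_div_rpow`).

In case (a), a Marcinkiewicz–Zygmund bound for T_j keeps R_i within 2(i+1)^(1-δ) of i/μ, off an
event of probability O((i+1)^(-p/2+δp)). On such an event the crude bound N_i ≥ i+1 loses a factor
of order (i+1)^(k/(μ+1)). Since k/(μ+1) < p/2 - 1, the sum of these losses has finite mean for small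
δ; this yields both almost sure summability and an integrable majorant.

In case (b), α = 1 and the product never exceeds e^k n^k. Summability follows from E R_i ≤ 1/P(τ >
i) = O(i^(1-ε)), which makes ∑ R_i/(i+1)² finite almost surely. -/

namespace ImmigrationUrn

/-! ### Counting the immigrants -/

/-- The number of black balls that have immigrated up to draw `n`. -/
noncomputable def immigrants (τ : ℕ → ℕ) (n : ℕ) : ℕ := ∑ m ∈ Finset.range (n + 1), arrivals τ m

theorem measurable_immigrants (n : ℕ) : Measurable fun τ : ℕ → ℕ => immigrants τ n :=
  Finset.measurable_fun_sum _ fun m _ => measurable_arrivals m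

theorem arrivalTime_mono (τ : ℕ → ℕ) : Monotone (arrivalTime τ) := fun _ _ h =>
  Finset.sum_le_sum_of_subset (Finset.range_subset_range.2 h)

/-- Since T is nondecreasing, T_j > i confines all arrivals up to draw i to indices below j. The
sets counted by `arrivals` are then finite, so `ncard` does not fall back to its default value 0. -/
theorem immigrants_eq_card {τ : ℕ → ℕ} {i j : ℕ} (h : i < arrivalTime τ j) :
    immigrants τ i = ((Finset.Ico 1 j).filter fun m => arrivalTime τ m ≤ i).card := by
  rw [Finset.card_eq_sum_card_fiberwise (f := arrivalTime τ) (t := Finset.range (i + 1))]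
  · refine Finset.sum_congr rfl fun n hn => ?_
    rw [Finset.mem_range] at hn
    rw [arrivals, ← Set.ncard_coe_finset]
    congr 1
    ext m
    simp only [Set.mem_ofPred_eq, Finset.coe_filter, Finset.mem_Ico, Finset.mem_filter]
    refine ⟨fun ⟨h1, h2⟩ => ⟨⟨⟨h1, ?_⟩, by omega⟩, h2⟩, fun ⟨⟨⟨h1, _⟩, _⟩, h2⟩ => ⟨h1, h2⟩⟩
    by_contra! hm
    have := arrivalTime_mono τ hm
    omega
  · intro m hm
    simp only [Finset.coe_filter, Set.mem_ofPred_eq] at hm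
    simp only [Finset.coe_range, Set.mem_Iio]
    omega

theorem immigrants_lt {τ : ℕ → ℕ} {i j : ℕ} (h : i < arrivalTime τ j) : immigrants τ i < j := by
  have hj : 0 < j := by
    rcases Nat.eq_zero_or_pos j with rfl | hj
    · simp [arrivalTime] at h
    · exact hj
  rw [immigrants_eq_card h]
  refine (Finset.card_filter_le _ _).trans_lt ?_
  simp only [Nat.card_Ico]
  omega

theorem le_immigrants {τ : ℕ → ℕ} {i j m : ℕ} (h : i < arrivalTime τ j)
    (hm : arrivalTime τ m ≤ i) : m ≤ immigrants τ i := by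
  rw [immigrants_eq_card h]
  have : Finset.Icc 1 m ⊆ (Finset.Ico 1 j).filter fun m => arrivalTime τ m ≤ i := by
    intro l hl
    simp only [Finset.mem_Icc, Finset.mem_filter, Finset.mem_Ico] at hl ⊢
    have h1 := arrivalTime_mono τ hl.2
    refine ⟨⟨hl.1, ?_⟩, by omega⟩
    by_contra! hlj
    have := arrivalTime_mono τ hlj
    omega
  simpa using Finset.card_le_card this

/-! ### Rising factorial moments given the arrival times -/

/-- The number of balls in the urn after `n` draws. -/
noncomputable def total (b w : ℕ) (τ : ℕ → ℕ) (n : ℕ) : ℕ := b + w + n + immigrants τ n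

theorem total_succ (b w : ℕ) (τ : ℕ → ℕ) (n : ℕ) :
    total b w τ (n + 1) = total b w τ n + 1 + arrivals τ (n + 1) := by
  simp only [total, immigrants, Finset.sum_range_succ _ (n + 1)]
  ring

theorem ae_contents_total {b w : ℕ} (τ : ℕ → ℕ) (n : ℕ) :
    ∀ᵐ s ∂contents b w τ n, s.1 + s.2 = total b w τ n := by
  induction n with
  | zero =>
    rw [contents, ae_dirac_eq]
    change w + (b + arrivals τ 0) = _
    simp only [total, immigrants, zero_add, Finset.sum_range_one]
    ring
  | succ n ih =>
    rw [contents, ae_iff,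
      Measure.bind_apply .of_discrete (measurable_of_countable _).aemeasurable,
      lintegral_congr_ae (g := fun _ => 0)]
    · simp
    · filter_upwards [ih] with s hs
      rw [Measure.map_apply (measurable_of_countable _) .of_discrete]
      have h1 : s.1 + 1 + (s.2 + arrivals τ (n + 1)) = total b w τ (n + 1) := by
        rw [total_succ, ← hs]; ring
      have h2 : s.1 + (s.2 + 1 + arrivals τ (n + 1)) = total b w τ (n + 1) := by
        rw [total_succ, ← hs]; ring
      simp [draw, h1, h2]

/-- This rests on x (x+1)⋯(x+k) = (x+k) · x(x+1)⋯(x+k-1): rising factorials are eigenfunctions of a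
Pólya draw. Immigration leaves the white count unchanged. -/
theorem lintegral_draw_ascFactorial (k a : ℕ) {s : ℕ × ℕ} (hs : 0 < s.1) :
    ∫⁻ s', (s'.1.ascFactorial k : ℝ≥0∞) ∂((draw s).map fun s' => (s'.1, s'.2 + a)) =
      s.1.ascFactorial k * ENNReal.ofReal (1 + k / ((s.1 + s.2 : ℕ) : ℝ)) := by
  rw [lintegral_map (measurable_of_countable _) (measurable_of_countable _), draw,
    lintegral_add_measure, lintegral_smul_measure, lintegral_smul_measure, lintegral_dirac,
    lintegral_dirac]
  have hN : (0 : ℝ) < ((s.1 + s.2 : ℕ) : ℝ) := by exact_mod_cast Nat.add_pos_left hs _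
  have h1 : ((s.1 : ℝ≥0∞) / (s.1 + s.2)) = ENNReal.ofReal (s.1 / ((s.1 + s.2 : ℕ) : ℝ)) := by
    rw [ENNReal.ofReal_div_of_pos hN, ENNReal.ofReal_natCast, ENNReal.ofReal_natCast]
    push_cast; rfl
  have h2 : ((s.2 : ℝ≥0∞) / (s.1 + s.2)) = ENNReal.ofReal (s.2 / ((s.1 + s.2 : ℕ) : ℝ)) := by
    rw [ENNReal.ofReal_div_of_pos hN, ENNReal.ofReal_natCast, ENNReal.ofReal_natCast]
    push_cast; rfl
  rw [h1, h2]
  simp only [smul_eq_mul]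
  rw [← ENNReal.ofReal_natCast, ← ENNReal.ofReal_natCast, ← ENNReal.ofReal_mul (by positivity),
    ← ENNReal.ofReal_mul (by positivity), ← ENNReal.ofReal_mul (by positivity),
    ← ENNReal.ofReal_add (by positivity) (by positivity)]
  congr 1
  have h3 : (s.1 : ℝ) * ((s.1 + 1).ascFactorial k : ℝ) = (s.1 + k) * (s.1.ascFactorial k : ℝ) := by
    exact_mod_cast Nat.succ_ascFactorial s.1 k
  field_simp
  push_cast
  linear_combination h3

/-- The factor by which the `k`-th rising factorial moment of the number of white balls grows
during the first `n` draws, given the inter-arrival times. -/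
noncomputable def growth (b w k : ℕ) (τ : ℕ → ℕ) (n : ℕ) : ℝ :=
  ∏ i ∈ Finset.range n, (1 + k / (total b w τ i : ℝ))

theorem growth_nonneg (b w k : ℕ) (τ : ℕ → ℕ) (n : ℕ) : 0 ≤ growth b w k τ n :=
  Finset.prod_nonneg fun _ _ => by positivity

theorem measurable_total (b w n : ℕ) : Measurable fun τ : ℕ → ℕ => (total b w τ n : ℝ) :=
  (measurable_of_countable fun a : ℕ => ((b + w + n + a : ℕ) : ℝ)).comp (measurable_immigrants n)

theorem measurable_growth (b w k n : ℕ) : Measurable fun τ : ℕ → ℕ => growth b w k τ n :=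
  Finset.measurable_fun_prod _ fun i _ =>
    measurable_const.add (measurable_const.div (measurable_total b w i))

theorem lintegral_ascFactorial_contents (b k : ℕ) {w : ℕ} (hw : 0 < w) (τ : ℕ → ℕ) (n : ℕ) :
    ∫⁻ s, (s.1.ascFactorial k : ℝ≥0∞) ∂contents b w τ n =
      w.ascFactorial k * ENNReal.ofReal (growth b w k τ n) := by
  induction n with
  | zero => simp [contents, growth]
  | succ n ih =>
    rw [contents, Measure.lintegral_bind (measurable_of_countable _).aemeasurable
      (measurable_of_countable _).aemeasurable]
    rw [lintegral_congr_ae (g := fun s => s.1.ascFactorial k *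
      ENNReal.ofReal (1 + k / (total b w τ n : ℝ)))]
    · rw [lintegral_mul_const _ (measurable_of_countable _), ih, mul_assoc,
        ← ENNReal.ofReal_mul (growth_nonneg b w k τ n), growth, growth, Finset.prod_range_succ]
    · filter_upwards [(isProbabilityMeasure_contents (b := b) hw τ n).2,
        ae_contents_total (b := b) (w := w) τ n] with s h1 h2
      rw [lintegral_draw_ascFactorial k _ h1, h2]

theorem lintegral_ascFactorial_urnLaw (n : ℕ) (π : Measure ℕ) (b k : ℕ) {w : ℕ} (hw : 0 < w) :
    ∫⁻ x, (x.ascFactorial k : ℝ≥0∞) ∂urnLaw n π b w =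
      w.ascFactorial k *
        ∫⁻ τ, ENNReal.ofReal (growth b w k τ n) ∂(Measure.infinitePi fun _ : ℕ => π) := by
  have hm : Measurable fun τ : ℕ → ℕ => (contents b w τ n).map Prod.fst :=
    (Measure.measurable_map _ measurable_fst).comp (measurable_contents b w n)
  rw [urnLaw, Measure.lintegral_bind hm.aemeasurable (measurable_of_countable _).aemeasurable,
    ← lintegral_const_mul _ (measurable_growth b w k n).ennreal_ofReal]
  refine lintegral_congr fun τ => ?_
  rw [lintegral_map (measurable_of_countable _) measurable_fst,
    lintegral_ascFactorial_contents b k hw]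

theorem integrable_growth (Q : Measure (ℕ → ℕ)) [IsFiniteMeasure Q] {b : ℕ} (hb : 0 < b)
    (w k n : ℕ) : Integrable (fun τ => growth b w k τ n) Q := by
  refine Integrable.of_bound (measurable_growth b w k n).aestronglyMeasurable ((1 + k) ^ n) ?_
  refine ae_of_all _ fun τ => ?_
  rw [Real.norm_of_nonneg (growth_nonneg ..), growth, ← Finset.card_range n, ← Finset.prod_const,
    Finset.card_range]
  refine Finset.prod_le_prod (fun i _ => by positivity) fun i _ => ?_
  have : (1 : ℝ) ≤ total b w τ i := by
    have : 1 ≤ total b w τ i := by unfold total; omega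
    exact_mod_cast this
  gcongr
  exact div_le_self (by positivity) this

theorem integrable_ascFactorial_urnLaw (n : ℕ) (π : Measure ℕ) [IsProbabilityMeasure π]
    {b w : ℕ} (hb : 0 < b) (hw : 0 < w) (k : ℕ) :
    Integrable (fun x : ℕ => (x.ascFactorial k : ℝ)) (urnLaw n π b w) ∧
    ∫ x : ℕ, (x.ascFactorial k : ℝ) ∂urnLaw n π b w =
      w.ascFactorial k * ∫ τ, growth b w k τ n ∂(Measure.infinitePi fun _ : ℕ => π) := by
  have h1 := lintegral_ascFactorial_urnLaw n π b k hw
  have h2 := ofReal_integral_eq_lintegral_ofReal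
    (integrable_growth (Measure.infinitePi fun _ : ℕ => π) hb w k n)
    (ae_of_all _ fun τ => growth_nonneg b w k τ n)
  rw [← h2] at h1
  have h3 : ∀ x : ℕ, (x.ascFactorial k : ℝ≥0∞) = ENNReal.ofReal (x.ascFactorial k : ℝ) :=
    fun x => (ENNReal.ofReal_natCast _).symm
  simp_rw [h3] at h1
  have hnn : 0 ≤ᵐ[urnLaw n π b w] fun x : ℕ => (x.ascFactorial k : ℝ) :=
    ae_of_all _ fun x => Nat.cast_nonneg _
  constructor
  · refine ⟨(measurable_of_countable _).aestronglyMeasurable, ?_⟩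
    rw [hasFiniteIntegral_iff_ofReal hnn, h1]
    exact ENNReal.mul_lt_top ENNReal.ofReal_lt_top ENNReal.ofReal_lt_top
  · rw [integral_eq_lintegral_of_nonneg_ae hnn (measurable_of_countable _).aestronglyMeasurable,
      h1, ENNReal.toReal_mul, ENNReal.toReal_ofReal (by positivity), ENNReal.toReal_ofReal]
    exact integral_nonneg fun τ => growth_nonneg b w k τ n

/-! ### Powers against rising factorials -/

theorem pow_le_ascFactorial (x k : ℕ) : x ^ k ≤ x.ascFactorial k := by
  induction k with
  | zero => simp
  | succ k ih =>
    rw [Nat.ascFactorial_succ, pow_succ']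
    exact Nat.mul_le_mul (Nat.le_add_right _ _) ih

/-- The error is expressed through the rising factorial one order lower, whose moment is of smaller
order in n. -/
theorem ascFactorial_le_pow_add (k : ℕ) : ∃ C : ℕ, ∀ x : ℕ,
    x.ascFactorial (k + 1) ≤ x ^ (k + 1) + C * x.ascFactorial k := by
  induction k with
  | zero => exact ⟨0, fun x => by simp [Nat.ascFactorial_succ]⟩
  | succ k ih =>
    obtain ⟨C, hC⟩ := ih
    refine ⟨k + 1 + 2 * C, fun x => ?_⟩
    rcases Nat.eq_zero_or_pos x with rfl | hx
    · simp [Nat.zero_ascFactorial]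
    have h1 : x.ascFactorial k ≤ x.ascFactorial (k + 1) := by
      rw [Nat.ascFactorial_succ]; exact Nat.le_mul_of_pos_left _ (by omega)
    have h2 := pow_le_ascFactorial x (k + 1)
    have h3 := hC x
    have h4 : x.ascFactorial (k + 1) = (x + k) * x.ascFactorial k := Nat.ascFactorial_succ ..
    calc x.ascFactorial (k + 1 + 1) = (x + (k + 1)) * x.ascFactorial (k + 1) :=
          Nat.ascFactorial_succ ..
      _ = x * x.ascFactorial (k + 1) + (k + 1) * x.ascFactorial (k + 1) := by ring
      _ ≤ x * (x ^ (k + 1) + C * x.ascFactorial k) + (k + 1) * x.ascFactorial (k + 1) := by gcongr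
      _ = x ^ (k + 1 + 1) + C * (x * x.ascFactorial k) + (k + 1) * x.ascFactorial (k + 1) := by
          ring
      _ ≤ x ^ (k + 1 + 1) + C * x.ascFactorial (k + 1) + (k + 1) * x.ascFactorial (k + 1) := by
          rw [h4]; gcongr; omega
      _ ≤ _ := by nlinarith [Nat.zero_le (C * x.ascFactorial (k + 1))]

/-! ### Asymptotics and domination of the products -/

theorem sum_inv_succ_eq_harmonic (n : ℕ) :
    ∑ i ∈ Finset.range n, 1 / ((i : ℝ) + 1) = (harmonic n : ℝ) := by
  simp [harmonic]

theorem exp_harmonic_le {n : ℕ} (hn : 0 < n) : Real.exp (harmonic n) ≤ Real.exp 1 * n := by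
  calc Real.exp (harmonic n) ≤ Real.exp (1 + Real.log n) :=
        Real.exp_le_exp.2 (harmonic_le_one_add_log n)
    _ = _ := by rw [Real.exp_add, Real.exp_log (by exact_mod_cast hn)]

theorem abs_log_one_add_sub_le {x : ℝ} (hx : 0 ≤ x) : |Real.log (1 + x) - x| ≤ x ^ 2 := by
  have h1 : Real.log (1 + x) ≤ x := by
    have := Real.log_le_sub_one_of_pos (x := 1 + x) (by positivity)
    linarith
  have h2 : 1 - (1 + x)⁻¹ ≤ Real.log (1 + x) := Real.one_sub_inv_le_log_of_pos (by positivity)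
  have h3 : x - x ^ 2 ≤ 1 - (1 + x)⁻¹ := by
    rw [← sub_nonneg]
    have : 1 - (1 + x)⁻¹ - (x - x ^ 2) = x ^ 3 / (1 + x) := by field_simp; ring
    rw [this]; positivity
  rw [abs_le]
  constructor <;> nlinarith

/-- Take logarithms: log(1 + k/N_i) is k/N_i up to O((i+1)⁻²), so the sum of logs minus kα times the
harmonic number converges, and the harmonic number is log n + γ + o(1). The limit is an exponential,
hence positive. -/
theorem exists_tendsto_prod_div_rpow (k : ℕ) (α : ℝ) {N : ℕ → ℝ} (hN : ∀ i : ℕ, (i : ℝ) + 1 ≤ N i)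
    (hs : Summable fun i : ℕ => |1 / N i - α / (i + 1)|) :
    ∃ z : ℝ, 0 < z ∧ Tendsto (fun n : ℕ => (∏ i ∈ Finset.range n, (1 + k / N i)) /
      (n : ℝ) ^ (k * α)) atTop (𝓝 z) := by
  have hpos : ∀ i, 0 < N i := fun i => lt_of_lt_of_le (by positivity) (hN i)
  have hsq : Summable fun i : ℕ => (k : ℝ) ^ 2 * (1 / ((i : ℝ) + 1) ^ 2) := by
    refine Summable.mul_left _ ?_
    exact_mod_cast (summable_nat_add_iff 1).2 (Real.summable_one_div_nat_pow.2 one_lt_two)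
  have hsum : Summable fun i : ℕ => Real.log (1 + k / N i) - k * α / (i + 1) := by
    refine Summable.of_norm_bounded (hsq.add (hs.mul_left (k : ℝ))) fun i => ?_
    have h1 := abs_log_one_add_sub_le (x := k / N i) (by have := hpos i; positivity)
    have h2 : (k / N i) ^ 2 ≤ (k : ℝ) ^ 2 * (1 / ((i : ℝ) + 1) ^ 2) := by
      rw [div_pow, mul_one_div]
      have := hN i
      gcongr
    have h3 : Real.log (1 + k / N i) - k * α / (i + 1) =
        (Real.log (1 + k / N i) - k / N i) + k * (1 / N i - α / (i + 1)) := by ring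
    rw [h3, Real.norm_eq_abs]
    refine (abs_add_le _ _).trans ?_
    rw [abs_mul, Nat.abs_cast]
    linarith
  refine ⟨Real.exp ((∑' i : ℕ, (Real.log (1 + k / N i) - k * α / (i + 1))) +
    k * α * Real.eulerMascheroniConstant), Real.exp_pos _, ?_⟩
  have ht := (Real.continuous_exp.tendsto _).comp (hsum.hasSum.tendsto_sum_nat.add
    (Real.tendsto_harmonic_sub_log.const_mul (k * α)))
  refine ht.congr' ?_
  filter_upwards [eventually_gt_atTop 0] with n hn
  have hn' : (0 : ℝ) < n := by exact_mod_cast hn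
  have h1 : ∏ i ∈ Finset.range n, (1 + k / N i) =
      Real.exp (∑ i ∈ Finset.range n, Real.log (1 + k / N i)) := by
    rw [Real.exp_sum]
    refine Finset.prod_congr rfl fun i _ => ?_
    rw [Real.exp_log]
    have := hpos i
    positivity
  simp only [Function.comp_apply]
  rw [h1, Real.rpow_def_of_pos hn', ← Real.exp_sub, Finset.sum_sub_distrib,
    ← sum_inv_succ_eq_harmonic, mul_sub, Finset.mul_sum]
  congr 1
  have : ∑ i ∈ Finset.range n, k * α / ((i : ℝ) + 1) =
      ∑ i ∈ Finset.range n, k * α * (1 / ((i : ℝ) + 1)) :=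
    Finset.sum_congr rfl fun i _ => by ring
  rw [this]
  ring

theorem exists_tendsto_integral_prod_div_rpow {Ω : Type*} [MeasurableSpace Ω] (Q : Measure Ω)
    [IsProbabilityMeasure Q] (k : ℕ) (α : ℝ) {N : ℕ → Ω → ℝ} (hm : ∀ i, Measurable (N i))
    (hN : ∀ (i : ℕ) ω, (i : ℝ) + 1 ≤ N i ω)
    (hs : ∀ᵐ ω ∂Q, Summable fun i : ℕ => |1 / N i ω - α / (i + 1)|)
    {G : Ω → ℝ} (hG : Integrable G Q)
    (hd : ∀ᵐ ω ∂Q, ∀ n : ℕ, 0 < n →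
      ∏ i ∈ Finset.range n, (1 + k / N i ω) ≤ G ω * (n : ℝ) ^ (k * α)) :
    ∃ m : ℝ, 0 < m ∧ Tendsto (fun n : ℕ => (∫ ω, ∏ i ∈ Finset.range n, (1 + k / N i ω) ∂Q) /
      (n : ℝ) ^ (k * α)) atTop (𝓝 m) := by
  have hlim : ∀ᵐ ω ∂Q, ∃ z : ℝ, 0 < z ∧ Tendsto (fun n : ℕ =>
      (∏ i ∈ Finset.range n, (1 + k / N i ω)) / (n : ℝ) ^ (k * α)) atTop (𝓝 z) := by
    filter_upwards [hs] with ω hω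
    exact exists_tendsto_prod_div_rpow k α (fun i => hN i ω) hω
  -- The limit is chosen pointwise, with the irrelevant value 0 where there is none; measurability
  -- of `Z` comes later from the almost everywhere convergence.
  have hlim' : ∀ ω, ∃ z : ℝ, (∃ z : ℝ, 0 < z ∧ Tendsto (fun n : ℕ =>
      (∏ i ∈ Finset.range n, (1 + k / N i ω)) / (n : ℝ) ^ (k * α)) atTop (𝓝 z)) →
      0 < z ∧ Tendsto (fun n : ℕ =>
      (∏ i ∈ Finset.range n, (1 + k / N i ω)) / (n : ℝ) ^ (k * α)) atTop (𝓝 z) := fun ω => by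
    by_cases h : ∃ z : ℝ, 0 < z ∧ Tendsto (fun n : ℕ =>
      (∏ i ∈ Finset.range n, (1 + k / N i ω)) / (n : ℝ) ^ (k * α)) atTop (𝓝 z)
    · obtain ⟨z, hz⟩ := h
      exact ⟨z, fun _ => hz⟩
    · exact ⟨0, fun h' => absurd h' h⟩
  choose Z hZ using hlim'
  have hmeas : ∀ n : ℕ, Measurable fun ω =>
      (∏ i ∈ Finset.range n, (1 + k / N i ω)) / (n : ℝ) ^ (k * α) := fun n =>
    (Finset.measurable_fun_prod _ fun i _ =>
      measurable_const.add (measurable_const.div (hm i))).div_const _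
  have hZlim : ∀ᵐ ω ∂Q, Tendsto (fun n : ℕ =>
      (∏ i ∈ Finset.range n, (1 + k / N i ω)) / (n : ℝ) ^ (k * α)) atTop (𝓝 (Z ω)) := by
    filter_upwards [hlim] with ω hω using (hZ ω hω).2
  have hZpos : ∀ᵐ ω ∂Q, 0 < Z ω := by
    filter_upwards [hlim] with ω hω using (hZ ω hω).1
  have hnn : ∀ (n : ℕ) ω, 0 ≤ (∏ i ∈ Finset.range n, (1 + k / N i ω)) / (n : ℝ) ^ (k * α) := by
    intro n ω
    refine div_nonneg (Finset.prod_nonneg fun i _ => ?_) (by positivity)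
    have : 0 < N i ω := lt_of_lt_of_le (by positivity) (hN i ω)
    positivity
  have hbd : ∀ᵐ ω ∂Q, ∀ n : ℕ, 0 < n →
      (∏ i ∈ Finset.range n, (1 + k / N i ω)) / (n : ℝ) ^ (k * α) ≤ G ω := by
    filter_upwards [hd] with ω hω n hn
    have : (0 : ℝ) < n := by exact_mod_cast hn
    rw [div_le_iff₀ (by positivity)]
    exact hω n hn
  have hZm : AEStronglyMeasurable Z Q :=
    aestronglyMeasurable_of_tendsto_ae atTop (fun n => (hmeas n).aestronglyMeasurable) hZlim
  have hZint : Integrable Z Q := by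
    refine hG.mono' hZm ?_
    filter_upwards [hZlim, hZpos, hbd] with ω h1 h2 h3
    rw [Real.norm_of_nonneg h2.le]
    exact le_of_tendsto h1 ((eventually_gt_atTop 0).mono fun n hn => h3 n hn)
  refine ⟨∫ ω, Z ω ∂Q, ?_, ?_⟩
  · rw [integral_pos_iff_support_of_nonneg_ae (hZpos.mono fun ω h => h.le) hZint]
    have : Function.support Z =ᵐ[Q] Set.univ := by
      rw [eventuallyEq_univ]
      filter_upwards [hZpos] with ω h using h.ne'
    rw [measure_congr this]
    simp
  · simp_rw [← integral_div]
    refine tendsto_integral_filter_of_dominated_convergence G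
      (.of_forall fun n => (hmeas n).aestronglyMeasurable) ?_ hG hZlim
    filter_upwards [eventually_gt_atTop 0] with n hn
    filter_upwards [hbd] with ω hω
    rw [Real.norm_of_nonneg (hnn n ω)]
    exact hω n hn

theorem prod_le_exp_harmonic (k : ℕ) {N : ℕ → ℝ} (hN : ∀ i : ℕ, (i : ℝ) + 1 ≤ N i) (n : ℕ) :
    ∏ i ∈ Finset.range n, (1 + k / N i) ≤ Real.exp (k * harmonic n) := by
  rw [← sum_inv_succ_eq_harmonic, Finset.mul_sum, Real.exp_sum]
  refine Finset.prod_le_prod (fun i _ => ?_) fun i _ => ?_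
  · have : 0 < N i := lt_of_lt_of_le (by positivity) (hN i)
    positivity
  · have := Real.add_one_le_exp (k * (1 / ((i : ℝ) + 1)))
    have h2 : k / N i ≤ k * (1 / ((i : ℝ) + 1)) := by
      rw [mul_one_div]
      have := hN i
      gcongr
    linarith

/-- A bound for the product that costs a power of `i + 1` for every index `i` in the
exceptional set `B`, off which `1 / N i` is close to `α / (i + 1)`. -/
theorem prod_le_of_exceptional (k : ℕ) {α : ℝ} {N c : ℕ → ℝ} (hN : ∀ i : ℕ, (i : ℝ) + 1 ≤ N i)
    (B : Set ℕ) (hc : ∀ i, 0 ≤ c i) (hB : ∀ i ∉ B, 1 / N i ≤ α / (i + 1) + c i) (n : ℕ) :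
    ∏ i ∈ Finset.range n, (1 + k / N i) ≤
      Real.exp (k * α * harmonic n + k * ∑ i ∈ Finset.range n, c i) *
        (1 + ∑ i ∈ Finset.range n, B.indicator
          (fun i => Real.exp (k * (1 - α) * harmonic (i + 1))) i) := by
  have hS : ∀ m, 0 ≤ ∑ i ∈ Finset.range m, B.indicator
      (fun i => Real.exp (k * (1 - α) * harmonic (i + 1))) i := fun m =>
    Finset.sum_nonneg fun i _ => Set.indicator_nonneg (fun _ _ => (Real.exp_pos _).le) i
  induction n with
  | zero => simp
  | succ n ih =>
    by_cases hn : n ∈ B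
    -- At an exceptional index the induction hypothesis is discarded: the crude bound on the whole
    -- product is paid for by the new summand alone. So only the last exceptional index really
    -- counts.
    · refine (prod_le_exp_harmonic k hN (n + 1)).trans ?_
      rw [Finset.sum_range_succ (fun i => B.indicator _ i), Set.indicator_of_mem hn]
      have h1 : Real.exp (k * harmonic (n + 1)) = Real.exp (k * α * harmonic (n + 1)) *
          Real.exp (k * (1 - α) * harmonic (n + 1)) := by
        rw [← Real.exp_add]; congr 1; ring
      rw [h1]
      have h2 : 0 ≤ k * ∑ i ∈ Finset.range (n + 1), c i :=
        mul_nonneg (Nat.cast_nonneg _) (Finset.sum_nonneg fun i _ => hc i)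
      gcongr
      · linarith
      · have := hS n
        linarith
    · rw [Finset.sum_range_succ (fun i => B.indicator _ i), Set.indicator_of_notMem hn, add_zero,
        Finset.prod_range_succ]
      have h0 : 0 < N n := lt_of_lt_of_le (by positivity) (hN n)
      have h1 : 1 + k / N n ≤ Real.exp (k * (α / (n + 1) + c n)) := by
        have h2 := Real.add_one_le_exp (k * (α / (n + 1) + c n))
        have h3 : k / N n ≤ k * (α / (n + 1) + c n) := by
          rw [← mul_one_div]
          exact mul_le_mul_of_nonneg_left (hB n hn) (Nat.cast_nonneg _)
        linarith
      have hS' := hS n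
      calc _ ≤ _ := mul_le_mul ih h1 (by positivity) (by positivity)
        _ = _ := by
          rw [mul_right_comm, ← Real.exp_add]
          congr 2
          rw [Finset.sum_range_succ, ← sum_inv_succ_eq_harmonic, ← sum_inv_succ_eq_harmonic,
            Finset.sum_range_succ]
          ring

theorem exp_mul_harmonic_le {c : ℝ} (hc : 0 ≤ c) {n : ℕ} (hn : 0 < n) :
    Real.exp (c * harmonic n) ≤ Real.exp c * (n : ℝ) ^ c := by
  have h := Real.rpow_le_rpow (Real.exp_pos _).le (exp_harmonic_le hn) hc
  rw [Real.mul_rpow (Real.exp_pos _).le (Nat.cast_nonneg _), ← Real.exp_mul, ← Real.exp_mul,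
    one_mul, mul_comm (harmonic n : ℝ)] at h
  exact h

/-! ### Moments of sums of independent centred variables -/

/-- For p|t| ≤ 1, use (1+t)^p ≤ exp(pt) ≤ 1 + pt + (pt)². Otherwise 1 ≤ p|t|, so |1+t| ≤ (p+1)|t|,
and p²t² absorbs the linear term. -/
theorem abs_one_add_rpow_le {p : ℝ} (hp : 2 ≤ p) (t : ℝ) :
    |1 + t| ^ p ≤ 1 + p * t + ((p + 1) ^ p + p ^ 2) * (t ^ 2 + |t| ^ p) := by
  have h0 : 0 ≤ |t| ^ p := by positivity
  have h1 : 1 ≤ (p + 1) ^ p := Real.one_le_rpow (by linarith) (by linarith)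
  rcases le_total (p * |t|) 1 with h | h
  · have ht : |t| ≤ 1 := by nlinarith [abs_nonneg t]
    have hpos : 0 ≤ 1 + t := by linarith [(abs_le.1 ht).1]
    have h2 : |1 + t| ^ p ≤ Real.exp (p * t) := by
      rw [abs_of_nonneg hpos, mul_comm, Real.exp_mul]
      refine Real.rpow_le_rpow hpos ?_ (by linarith)
      linarith [Real.add_one_le_exp t]
    have h3 : |p * t| ≤ 1 := by rwa [abs_mul, abs_of_nonneg (by linarith)]
    have h4 := (abs_le.1 (Real.abs_exp_sub_one_sub_id_le h3)).2
    nlinarith [mul_nonneg (sq_nonneg p) h0, mul_nonneg (zero_le_one.trans h1) (sq_nonneg t),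
      mul_nonneg (zero_le_one.trans h1) h0]
  · have h2 : |1 + t| ^ p ≤ (p + 1) ^ p * |t| ^ p := by
      rw [← Real.mul_rpow (by linarith) (abs_nonneg t)]
      refine Real.rpow_le_rpow (abs_nonneg _) ?_ (by linarith)
      refine (abs_add_le _ _).trans ?_
      rw [abs_one]
      linarith
    have h3 : p * |t| ≤ p ^ 2 * t ^ 2 := by
      rw [← sq_abs t]
      nlinarith
    have h4 : -(p * |t|) ≤ p * t := by nlinarith [neg_abs_le t]
    nlinarith [mul_nonneg (sq_nonneg p) h0, mul_nonneg (zero_le_one.trans h1) (sq_nonneg t)]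

/-- The previous bound rescaled by x. The term linear in y is kept exact because it integrates to 0
when y is centred and independent of x. -/
theorem abs_add_rpow_le {p : ℝ} (hp : 2 ≤ p) (x y : ℝ) :
    |x + y| ^ p ≤ |x| ^ p + p * ((x * |x| ^ (p - 2)) * y) +
      ((p + 1) ^ p + p ^ 2) * (|x| ^ (p - 2) * y ^ 2 + |y| ^ p) := by
  rcases eq_or_ne x 0 with rfl | hx
  · have h0 : 0 ≤ |y| ^ p := by positivity
    have h1 : 1 ≤ (p + 1) ^ p := Real.one_le_rpow (by linarith) (by linarith)
    have h2 : 0 ≤ |(0 : ℝ)| ^ (p - 2) * y ^ 2 := by positivity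
    simp only [zero_add, zero_mul, mul_zero, add_zero]
    have h3 : 0 ≤ |(0 : ℝ)| ^ p := by positivity
    nlinarith [mul_nonneg (sq_nonneg p) h0, mul_nonneg (sq_nonneg p) h2,
      mul_nonneg (zero_le_one.trans h1) h2, mul_nonneg (sub_nonneg.2 h1) h0]
  · obtain ⟨t, rfl⟩ : ∃ t, y = x * t := ⟨y / x, by field_simp⟩
    have hx' : 0 < |x| := abs_pos.2 hx
    have h1 : |x| ^ p = |x| ^ (p - 2) * x ^ 2 := by
      rw [← sq_abs x, ← Real.rpow_natCast |x| 2, ← Real.rpow_add hx']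
      norm_num
    have h2 : x + x * t = x * (1 + t) := by ring
    rw [h2, abs_mul, Real.mul_rpow (abs_nonneg _) (abs_nonneg _), abs_mul,
      Real.mul_rpow (abs_nonneg _) (abs_nonneg _)]
    have h3 := mul_le_mul_of_nonneg_left (abs_one_add_rpow_le hp t)
      (by positivity : 0 ≤ |x| ^ p)
    refine h3.trans (le_of_eq ?_)
    linear_combination (p * t + ((p + 1) ^ p + p ^ 2) * t ^ 2) * h1

theorem rpow_le_one_add_rpow {u a p : ℝ} (hu : 0 ≤ u) (ha : 0 ≤ a) (hap : a ≤ p) :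
    u ^ a ≤ 1 + u ^ p := by
  have h0 : 0 ≤ u ^ p := by positivity
  rcases le_total u 1 with h | h
  · have := Real.rpow_le_one hu h ha
    linarith
  · have := Real.rpow_le_rpow_of_exponent_le h hap
    linarith

section Moments

variable {Ω : Type*} [MeasurableSpace Ω] {Q : Measure Ω}

theorem integrable_abs_rpow_of_le [IsFiniteMeasure Q] {X : Ω → ℝ} (hX : Measurable X) {a p : ℝ}
    (ha : 0 ≤ a) (hap : a ≤ p) (h : Integrable (fun ω => |X ω| ^ p) Q) :
    Integrable (fun ω => |X ω| ^ a) Q := by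
  refine ((integrable_const (1 : ℝ)).add h).mono' (by fun_prop) (ae_of_all _ fun ω => ?_)
  rw [Real.norm_of_nonneg (by positivity)]
  exact rpow_le_one_add_rpow (abs_nonneg _) ha hap

theorem integral_abs_add_rpow_le [IsProbabilityMeasure Q] {p : ℝ} (hp : 2 ≤ p) {S Y : Ω → ℝ}
    (hS : Measurable S) (hY : Measurable Y) (hSY : IndepFun S Y Q)
    (hSp : Integrable (fun ω => |S ω| ^ p) Q) (hYp : Integrable (fun ω => |Y ω| ^ p) Q)
    (hY0 : ∫ ω, Y ω ∂Q = 0) :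
    Integrable (fun ω => |S ω + Y ω| ^ p) Q ∧
    ∫ ω, |S ω + Y ω| ^ p ∂Q ≤ ∫ ω, |S ω| ^ p ∂Q + ((p + 1) ^ p + p ^ 2) *
      ((∫ ω, |S ω| ^ (p - 2) ∂Q) * (∫ ω, Y ω ^ 2 ∂Q) + ∫ ω, |Y ω| ^ p ∂Q) := by
  have hY1 : Integrable Y Q := by
    have := integrable_abs_rpow_of_le hY zero_le_one (by linarith) hYp
    simp only [Real.rpow_one] at this
    exact (integrable_norm_iff hY.aestronglyMeasurable).1 this
  have hY2 : Integrable (fun ω => Y ω ^ 2) Q := by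
    have := integrable_abs_rpow_of_le hY zero_le_two hp hYp
    simpa only [Real.rpow_two, sq_abs] using this
  have hS2 : Integrable (fun ω => |S ω| ^ (p - 2)) Q :=
    integrable_abs_rpow_of_le hS (by linarith) (by linarith) hSp
  have hg : Measurable fun x : ℝ => x * |x| ^ (p - 2) := by fun_prop
  have hS1 : Integrable (fun ω => S ω * |S ω| ^ (p - 2)) Q := by
    refine (integrable_abs_rpow_of_le hS (a := p - 1) (by linarith) (by linarith) hSp).mono'
      (by fun_prop) (ae_of_all _ fun ω => ?_)
    rw [norm_mul, Real.norm_eq_abs, Real.norm_of_nonneg (by positivity)]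
    rcases eq_or_ne (S ω) 0 with h | h
    · rw [h, abs_zero, zero_mul]; positivity
    · nth_rewrite 1 [← Real.rpow_one |S ω|]
      rw [← Real.rpow_add (abs_pos.2 h)]
      exact le_of_eq (by ring_nf)
  have hi1 : IndepFun (fun ω => S ω * |S ω| ^ (p - 2)) Y Q := hSY.comp hg measurable_id
  have hi2 : IndepFun (fun ω => |S ω| ^ (p - 2)) (fun ω => Y ω ^ 2) Q :=
    hSY.comp (φ := fun x : ℝ => |x| ^ (p - 2)) (ψ := fun x : ℝ => x ^ 2) (by fun_prop)
      (by fun_prop)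
  have I1 : Integrable (fun ω => S ω * |S ω| ^ (p - 2) * Y ω) Q := hi1.integrable_mul hS1 hY1
  have I2 : Integrable (fun ω => |S ω| ^ (p - 2) * Y ω ^ 2) Q := hi2.integrable_mul hS2 hY2
  have E1 : ∫ ω, S ω * |S ω| ^ (p - 2) * Y ω ∂Q = 0 := by
    rw [hi1.integral_fun_mul_eq_mul_integral hS1.aestronglyMeasurable hY1.aestronglyMeasurable,
      hY0, mul_zero]
  have E2 : ∫ ω, |S ω| ^ (p - 2) * Y ω ^ 2 ∂Q =
      (∫ ω, |S ω| ^ (p - 2) ∂Q) * ∫ ω, Y ω ^ 2 ∂Q :=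
    hi2.integral_fun_mul_eq_mul_integral hS2.aestronglyMeasurable hY2.aestronglyMeasurable
  have hle : ∀ ω, |S ω + Y ω| ^ p ≤ |S ω| ^ p + p * (S ω * |S ω| ^ (p - 2) * Y ω) +
      ((p + 1) ^ p + p ^ 2) * (|S ω| ^ (p - 2) * Y ω ^ 2 + |Y ω| ^ p) :=
    fun ω => abs_add_rpow_le hp _ _
  have hI : Integrable (fun ω => |S ω| ^ p + p * (S ω * |S ω| ^ (p - 2) * Y ω) +
      ((p + 1) ^ p + p ^ 2) * (|S ω| ^ (p - 2) * Y ω ^ 2 + |Y ω| ^ p)) Q :=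
    (hSp.add (I1.const_mul p)).add ((I2.add hYp).const_mul _)
  have hI' : Integrable (fun ω => |S ω + Y ω| ^ p) Q := by
    have hp0 : 0 ≤ p := by linarith
    refine hI.mono' (by fun_prop) (ae_of_all _ fun ω => ?_)
    rw [Real.norm_of_nonneg (by positivity)]
    exact hle ω
  refine ⟨hI', (integral_mono hI' hI hle).trans (le_of_eq ?_)⟩
  have hA : Integrable (fun ω => |S ω| ^ p + p * (S ω * |S ω| ^ (p - 2) * Y ω)) Q :=
    hSp.add (I1.const_mul p)
  have hB : Integrable (fun ω => ((p + 1) ^ p + p ^ 2) *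
      (|S ω| ^ (p - 2) * Y ω ^ 2 + |Y ω| ^ p)) Q := (I2.add hYp).const_mul _
  rw [integral_add hA hB, integral_add hSp (I1.const_mul p), integral_const_mul,
    integral_const_mul, integral_add I2 hYp, E1, E2]
  ring

/-- Truncation at level l. With l² proportional to j, the (p-2)-th moment of a sum of j terms is
controlled by its p-th moment with a small coefficient. -/
theorem rpow_sub_two_le {u l p : ℝ} (hu : 0 ≤ u) (hl : 0 < l) (hp : 2 ≤ p) :
    u ^ (p - 2) ≤ u ^ p / l ^ 2 + l ^ (p - 2) := by
  rcases le_total u l with h | h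
  · have h1 := Real.rpow_le_rpow hu h (by linarith : 0 ≤ p - 2)
    have : 0 ≤ u ^ p / l ^ 2 := by positivity
    linarith
  · have hu' : 0 < u := hl.trans_le h
    have h1 : u ^ p = u ^ (p - 2) * u ^ 2 := by
      rw [← Real.rpow_natCast u 2, ← Real.rpow_add hu']
      norm_num
    have h2 : u ^ (p - 2) ≤ u ^ p / l ^ 2 := by
      rw [h1, le_div_iff₀ (by positivity)]
      gcongr
    have : 0 ≤ l ^ (p - 2) := by positivity
    linarith

/-- A moment bound of Marcinkiewicz–Zygmund type. -/
theorem exists_integral_abs_sum_rpow_le [IsProbabilityMeasure Q] {p : ℝ} (hp : 2 ≤ p)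
    {X : ℕ → Ω → ℝ} (hX : ∀ i, Measurable (X i)) (hind : iIndepFun X Q)
    (hXp : ∀ i, Integrable (fun ω => |X i ω| ^ p) Q) (hX0 : ∀ i, ∫ ω, X i ω ∂Q = 0)
    {v : ℝ} (hv2 : ∀ i, ∫ ω, X i ω ^ 2 ∂Q ≤ v) (hvp : ∀ i, ∫ ω, |X i ω| ^ p ∂Q ≤ v) :
    ∃ K : ℝ, 0 ≤ K ∧ ∀ j : ℕ, Integrable (fun ω => |∑ i ∈ Finset.range j, X i ω| ^ p) Q ∧
      ∫ ω, |∑ i ∈ Finset.range j, X i ω| ^ p ∂Q ≤ K * (j : ℝ) ^ (p / 2) := by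
  have hv : 0 ≤ v := (integral_nonneg fun ω => sq_nonneg (X 0 ω)).trans (hv2 0)
  set C := (p + 1) ^ p + p ^ 2 with hC
  have hC0 : 0 ≤ C := by positivity
  -- `M` makes C v / M ≤ 1/2, so the p-th moment fed back through truncation costs at most half of
  -- the allowed increment K j^(p/2-1). `K` is chosen so that the other half covers the remaining
  -- terms, and K ≥ v starts the induction.
  set M := 2 * C * v + 1 with hM
  have hM0 : 0 < M := by positivity
  set K := 2 * (C * v * M ^ (p / 2 - 1) + C * v) + v with hK
  have hK0 : 0 ≤ K := by positivity
  have hmeas : ∀ j : ℕ, Measurable fun ω => ∑ i ∈ Finset.range j, X i ω := fun j =>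
    Finset.measurable_fun_sum _ fun i _ => hX i
  refine ⟨K, hK0, fun j => ?_⟩
  induction j with
  | zero =>
    have hp0 : p ≠ 0 := by linarith
    have hp1 : p / 2 ≠ 0 := by linarith
    simp [Real.zero_rpow, hp0]
  | succ j ih =>
    have hij : IndepFun (fun ω => ∑ i ∈ Finset.range j, X i ω) (X j) Q := by
      have := hind.indepFun_finsetSum_of_notMem hX (s := Finset.range j) (i := j) (by simp)
      convert this using 1
      ext ω
      simp
    obtain ⟨h1, h2⟩ := integral_abs_add_rpow_le hp (hmeas j) (hX j) hij ih.1 (hXp j) (hX0 j)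
    simp_rw [Finset.sum_range_succ]
    refine ⟨h1, ?_⟩
    rcases Nat.eq_zero_or_pos j with rfl | hj
    · have hKv : v ≤ K := by
        rw [hK]
        have : 0 ≤ C * v * M ^ (p / 2 - 1) + C * v := by positivity
        linarith
      simpa using (hvp 0).trans hKv
    · refine h2.trans ?_
      have hj' : (1 : ℝ) ≤ j := by exact_mod_cast hj
      have hj0 : (0 : ℝ) < j := by linarith
      set l := √(M * j) with hl
      have hl0 : 0 < l := Real.sqrt_pos.2 (by positivity)
      have hl2 : l ^ 2 = M * j := Real.sq_sqrt (by positivity)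
      have hlp : l ^ (p - 2) = M ^ (p / 2 - 1) * (j : ℝ) ^ (p / 2 - 1) := by
        rw [hl, Real.sqrt_eq_rpow, ← Real.rpow_mul (by positivity),
          ← Real.mul_rpow hM0.le hj0.le]
        congr 1; ring
      set J := (j : ℝ) ^ (p / 2 - 1) with hJ
      have hJ1 : 1 ≤ J := Real.one_le_rpow hj' (by linarith)
      have hJ2 : (j : ℝ) ^ (p / 2) = J * j := by
        rw [hJ, ← Real.rpow_add_one hj0.ne']; ring_nf
      have h3 : ∫ ω, |∑ i ∈ Finset.range j, X i ω| ^ (p - 2) ∂Q ≤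
          (K / M + M ^ (p / 2 - 1)) * J := by
        have : ∫ ω, |∑ i ∈ Finset.range j, X i ω| ^ (p - 2) ∂Q ≤
            ∫ ω, (|∑ i ∈ Finset.range j, X i ω| ^ p / l ^ 2 + l ^ (p - 2)) ∂Q :=
          integral_mono (integrable_abs_rpow_of_le (hmeas j) (by linarith) (by linarith) ih.1)
            ((ih.1.div_const _).add (integrable_const _))
            fun ω => rpow_sub_two_le (abs_nonneg _) hl0 hp
        refine this.trans ?_
        rw [integral_add (ih.1.div_const _) (integrable_const _), integral_div, integral_const,
          probReal_univ, one_smul, hlp, add_mul]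
        gcongr
        rw [div_le_iff₀ (by positivity), hl2]
        refine ih.2.trans (le_of_eq ?_)
        rw [hJ2]
        field_simp
      have h4 : J * (j + 1) ≤ ((j : ℝ) + 1) ^ (p / 2) := by
        have : ((j : ℝ) + 1) ^ (p / 2) = ((j : ℝ) + 1) ^ (p / 2 - 1) * (j + 1) := by
          rw [← Real.rpow_add_one (by positivity)]; ring_nf
        rw [this]
        have : J ≤ ((j : ℝ) + 1) ^ (p / 2 - 1) :=
          Real.rpow_le_rpow hj0.le (by linarith) (by linarith)
        gcongr
      have h5 : (∫ ω, |∑ i ∈ Finset.range j, X i ω| ^ (p - 2) ∂Q) * ∫ ω, X j ω ^ 2 ∂Q ≤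
          (K / M + M ^ (p / 2 - 1)) * J * v :=
        mul_le_mul h3 (hv2 j) (integral_nonneg fun ω => sq_nonneg _) (by positivity)
      have h6 : C * (K / M * J * v) ≤ K / 2 * J := by
        have : C * v / M ≤ 1 / 2 := by
          rw [div_le_iff₀ hM0, hM]; linarith
        calc C * (K / M * J * v) = C * v / M * (K * J) := by ring
          _ ≤ 1 / 2 * (K * J) := by gcongr
          _ = _ := by ring
      have h7 := ih.2
      rw [hJ2] at h7
      have h8 := mul_le_mul_of_nonneg_left h5 hC0
      have h9 := mul_le_mul_of_nonneg_left (hvp j) hC0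
      have h10 := mul_le_mul_of_nonneg_left h4 hK0
      have h11 : C * v ≤ C * v * J := le_mul_of_one_le_right (by positivity) hJ1
      have h12 : 0 ≤ v * J := by positivity
      push_cast
      have h13 : K * J = 2 * (C * v * M ^ (p / 2 - 1) * J + C * v * J) + v * J := by
        rw [hK]; ring
      nlinarith

end Moments

/-! ### Concentration of the number of immigrants -/

theorem integrable_rpow_of_lintegral_lt_top {π : Measure ℕ} {p : ℝ} (hp : 0 ≤ p)
    (h : ∫⁻ j, (j : ℝ≥0∞) ^ p ∂π < ∞) : Integrable (fun j : ℕ => (j : ℝ) ^ p) π := by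
  refine ⟨(measurable_of_countable _).aestronglyMeasurable, ?_⟩
  rw [hasFiniteIntegral_iff_ofReal (ae_of_all _ fun j => by positivity)]
  refine lt_of_eq_of_lt (lintegral_congr fun j => ?_) h
  rw [← ENNReal.ofReal_rpow_of_nonneg (Nat.cast_nonneg j) hp, ENNReal.ofReal_natCast]

theorem exists_integral_abs_arrivalTime_sub_rpow_le (π : Measure ℕ) [IsProbabilityMeasure π]
    {p : ℝ} (hp : 2 ≤ p) (hπ : Integrable (fun j : ℕ => (j : ℝ) ^ p) π) {μ : ℝ}
    (hμ : ∫ j : ℕ, (j : ℝ) ∂π = μ) :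
    ∃ K : ℝ, 0 ≤ K ∧ ∀ j : ℕ,
      Integrable (fun τ => |(arrivalTime τ j : ℝ) - j * μ| ^ p)
        (Measure.infinitePi fun _ : ℕ => π) ∧
      ∫ τ, |(arrivalTime τ j : ℝ) - j * μ| ^ p ∂(Measure.infinitePi fun _ : ℕ => π) ≤
        K * (j : ℝ) ^ (p / 2) := by
  have hp0 : 0 ≤ p := by linarith
  have hμ0 : 0 ≤ μ := hμ ▸ integral_nonneg fun j => Nat.cast_nonneg j
  have hI : Integrable (fun j : ℕ => |(j : ℝ) - μ| ^ p) π := by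
    refine (hπ.add (integrable_const (μ ^ p))).mono'
      (measurable_of_countable _).aestronglyMeasurable (ae_of_all _ fun j => ?_)
    rw [Real.norm_of_nonneg (by positivity)]
    have hj : (0 : ℝ) ≤ j := Nat.cast_nonneg j
    have h1 : 0 ≤ (j : ℝ) ^ p := by positivity
    have h2 : 0 ≤ μ ^ p := by positivity
    change _ ≤ (j : ℝ) ^ p + μ ^ p
    rcases le_total (j : ℝ) μ with h | h
    · have := Real.rpow_le_rpow (abs_nonneg ((j : ℝ) - μ)) (z := p) (y := μ)
        (by rw [abs_le]; constructor <;> linarith) hp0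
      linarith
    · have := Real.rpow_le_rpow (abs_nonneg ((j : ℝ) - μ)) (z := p) (y := j)
        (by rw [abs_le]; constructor <;> linarith) hp0
      linarith
  have hI1 : Integrable (fun j : ℕ => (j : ℝ)) π := by
    refine ((integrable_const (1 : ℝ)).add hπ).mono'
      (measurable_of_countable _).aestronglyMeasurable (ae_of_all _ fun j => ?_)
    have := rpow_le_one_add_rpow (Nat.cast_nonneg j) zero_le_one (by linarith : (1 : ℝ) ≤ p)
    rw [Real.rpow_one] at this
    simpa using this
  have hmp : ∀ i : ℕ, MeasurePreserving (fun τ : ℕ → ℕ => τ i)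
      (Measure.infinitePi fun _ : ℕ => π) π := fun i => measurePreserving_eval_infinitePi _ i
  have hmap : ∀ (f : ℕ → ℝ) (i : ℕ), ∫ τ, f (τ i) ∂(Measure.infinitePi fun _ : ℕ => π) =
      ∫ j, f j ∂π := fun f i => by
    have := integral_map (μ := Measure.infinitePi fun _ : ℕ => π)
      (hmp i).measurable.aemeasurable (measurable_of_countable f).aestronglyMeasurable
    rw [(hmp i).map_eq] at this
    exact this.symm
  obtain ⟨K, hK0, hK⟩ := exists_integral_abs_sum_rpow_le
    (Q := Measure.infinitePi fun _ : ℕ => π) hp (X := fun i τ => (τ i : ℝ) - μ)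
    (fun i => (measurable_of_countable fun a : ℕ => (a : ℝ) - μ).comp (measurable_pi_apply i))
    (iIndepFun_infinitePi (X := fun _ (a : ℕ) => (a : ℝ) - μ) fun _ => measurable_of_countable _)
    (fun i => (hmp i).integrable_comp_of_integrable hI)
    (fun i => by
      rw [hmap (fun j => (j : ℝ) - μ), integral_sub hI1 (integrable_const μ), hμ]
      simp)
    (v := max (∫ j : ℕ, ((j : ℝ) - μ) ^ 2 ∂π) (∫ j : ℕ, |(j : ℝ) - μ| ^ p ∂π))
    (fun i => (hmap (fun j => ((j : ℝ) - μ) ^ 2) i).le.trans (le_max_left _ _))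
    (fun i => (hmap (fun j => |(j : ℝ) - μ| ^ p) i).le.trans (le_max_right _ _))
  refine ⟨K, hK0, fun j => ?_⟩
  have h : ∀ τ : ℕ → ℕ, (arrivalTime τ j : ℝ) - j * μ = ∑ i ∈ Finset.range j, ((τ i : ℝ) - μ) := by
    intro τ
    rw [Finset.sum_sub_distrib, arrivalTime]
    simp
  simp_rw [h]
  exact hK j

theorem natCast_add_one_le_total {b : ℕ} (hb : 0 < b) (w : ℕ) (i : ℕ) (τ : ℕ → ℕ) :
    (i : ℝ) + 1 ≤ total b w τ i := by
  have : i + 1 ≤ total b w τ i := by unfold total; omega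
  exact_mod_cast this

/-- If the inter-arrival times have a sufficiently high moment, then the number of immigrants is
close to its mean up to a power saving, off events whose probabilities decay fast. -/
theorem exists_measureReal_exceptional_le (π : Measure ℕ) [IsProbabilityMeasure π]
    {p : ℝ} (hp : 2 ≤ p) (hπ : Integrable (fun j : ℕ => (j : ℝ) ^ p) π) {μ : ℝ} (hμ0 : 0 < μ)
    (hμ : ∫ j : ℕ, (j : ℝ) ∂π = μ) {β : ℝ} (hβ0 : 0 ≤ β) (hβ1 : β ≤ 1) :
    ∃ (B : ℕ → Set (ℕ → ℕ)) (C : ℝ), (∀ i, MeasurableSet (B i)) ∧ 0 ≤ C ∧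
      (∀ i, (Measure.infinitePi fun _ : ℕ => π).real (B i) ≤
        C * ((i : ℝ) + 1) ^ (p / 2 - β * p)) ∧
      ∀ i, ∀ τ ∉ B i, |(immigrants τ i : ℝ) - i / μ| ≤ 2 * ((i : ℝ) + 1) ^ β := by
  obtain ⟨K, hK0, hK⟩ := exists_integral_abs_arrivalTime_sub_rpow_le π hp hπ hμ
  set Q := Measure.infinitePi fun _ : ℕ => π with hQ
  have hp0 : 0 < p := by linarith
  have hu1 : ∀ i : ℕ, (1 : ℝ) ≤ (i : ℝ) + 1 := fun i => by
    have : (0 : ℝ) ≤ i := Nat.cast_nonneg i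
    linarith
  have hub1 : ∀ i : ℕ, 1 ≤ ((i : ℝ) + 1) ^ β := fun i => Real.one_le_rpow (hu1 i) hβ0
  have hub2 : ∀ i : ℕ, ((i : ℝ) + 1) ^ β ≤ (i : ℝ) + 1 := fun i => by
    simpa using Real.rpow_le_rpow_of_exponent_le (hu1 i) hβ1
  set D := 1 / μ + 2 with hD
  have hD0 : 0 < D := by positivity
  set C := K * D ^ (p / 2) / μ ^ p with hC
  have hC0 : 0 ≤ C := by positivity
  -- Deviation events, stated with p-th powers so that Markov's inequality applies directly.
  set E : ℕ → ℕ → Set (ℕ → ℕ) := fun i j =>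
    {τ | (μ * ((i : ℝ) + 1) ^ β) ^ p ≤ |(arrivalTime τ j : ℝ) - j * μ| ^ p} with hE
  have htail : ∀ i j : ℕ, (j : ℝ) ≤ D * ((i : ℝ) + 1) →
      Q.real (E i j) ≤ C * ((i : ℝ) + 1) ^ (p / 2 - β * p) := by
    intro i j hj
    have hu0 : (0 : ℝ) < (i : ℝ) + 1 := by positivity
    have h1 := mul_meas_ge_le_integral_of_nonneg
      (ae_of_all Q fun τ => (by positivity : 0 ≤ |(arrivalTime τ j : ℝ) - j * μ| ^ p))
      (hK j).1 ((μ * ((i : ℝ) + 1) ^ β) ^ p)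
    have h2 : (j : ℝ) ^ (p / 2) ≤ (D * ((i : ℝ) + 1)) ^ (p / 2) :=
      Real.rpow_le_rpow (Nat.cast_nonneg j) hj (by linarith)
    have h3 := h1.trans ((hK j).2.trans (mul_le_mul_of_nonneg_left h2 hK0))
    rw [← le_div_iff₀' (by positivity)] at h3
    refine h3.trans (le_of_eq ?_)
    rw [Real.mul_rpow hD0.le hu0.le, Real.mul_rpow hμ0.le (by positivity), ← Real.rpow_mul hu0.le,
      Real.rpow_sub hu0, hC]
    field_simp
  -- If T_jm ≤ i < T_jp, then R_i lies between jm and jp. Rounding costs at most 1 ≤ (i+1)^β, whence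
  -- the factor 2 in the conclusion.
  set jp : ℕ → ℕ := fun i => ⌈(i : ℝ) / μ + ((i : ℝ) + 1) ^ β⌉₊ with hjp
  set jm : ℕ → ℕ := fun i => ⌊(i : ℝ) / μ - ((i : ℝ) + 1) ^ β⌋₊ with hjm
  have hjp1 : ∀ i : ℕ, (i : ℝ) / μ + ((i : ℝ) + 1) ^ β ≤ jp i := fun i => Nat.le_ceil _
  have hjp2 : ∀ i : ℕ, (jp i : ℝ) < (i : ℝ) / μ + ((i : ℝ) + 1) ^ β + 1 := fun i =>
    Nat.ceil_lt_add_one (by positivity)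
  have hjm1 : ∀ i : ℕ, (i : ℝ) / μ - ((i : ℝ) + 1) ^ β < jm i + 1 := fun i => Nat.lt_floor_add_one _
  have hDi : ∀ i : ℕ, (i : ℝ) / μ + ((i : ℝ) + 1) ^ β + 1 ≤ D * ((i : ℝ) + 1) := fun i => by
    have h1 := hub2 i
    have h2 : (i : ℝ) / μ ≤ 1 / μ * ((i : ℝ) + 1) := by
      rw [div_mul_eq_mul_div, one_mul]; gcongr; linarith
    rw [hD, add_mul]
    have : (0 : ℝ) ≤ i := Nat.cast_nonneg i
    linarith
  have hB1 : ∀ i, {τ | arrivalTime τ (jp i) ≤ i} ⊆ E i (jp i) := by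
    intro i τ hτ
    have hτ' : (arrivalTime τ (jp i) : ℝ) ≤ i := by exact_mod_cast hτ
    refine Real.rpow_le_rpow (by positivity) ?_ hp0.le
    have h1 := mul_le_mul_of_nonneg_right (hjp1 i) hμ0.le
    rw [add_mul, div_mul_cancel₀ _ hμ0.ne'] at h1
    rw [abs_sub_comm]
    refine le_trans ?_ (le_abs_self _)
    linarith
  have hB2 : ∀ i, {τ | i < arrivalTime τ (jm i)} ⊆ E i (jm i) := by
    intro i τ hτ
    have hτ' : (i : ℝ) < arrivalTime τ (jm i) := by exact_mod_cast hτ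
    -- If this were negative, the floor would be 0 and T_0 = 0 could not exceed i.
    have hpos : 0 ≤ (i : ℝ) / μ - ((i : ℝ) + 1) ^ β := by
      by_contra! h
      have h0 : jm i = 0 := Nat.floor_of_nonpos h.le
      have : i < arrivalTime τ (jm i) := hτ
      rw [h0] at this
      simp [arrivalTime] at this
    refine Real.rpow_le_rpow (by positivity) ?_ hp0.le
    have h1 := mul_le_mul_of_nonneg_right (Nat.floor_le hpos) hμ0.le
    rw [sub_mul, div_mul_cancel₀ _ hμ0.ne'] at h1
    refine le_trans ?_ (le_abs_self _)
    change _ ≤ _ - (jm i : ℝ) * μ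
    linarith
  refine ⟨fun i => {τ | arrivalTime τ (jp i) ≤ i} ∪ {τ | i < arrivalTime τ (jm i)}, 2 * C,
    fun i => ?_, by positivity, fun i => ?_, fun i τ hτ => ?_⟩
  · exact (measurableSet_le (measurable_arrivalTime _) measurable_const).union
      (measurableSet_lt measurable_const (measurable_arrivalTime _))
  · refine (measureReal_union_le _ _).trans ?_
    have h1 := (measureReal_mono (hB1 i)).trans (htail i (jp i) ((hjp2 i).le.trans (hDi i)))
    have h2 : (jm i : ℝ) ≤ D * ((i : ℝ) + 1) := by
      refine le_trans ?_ (hDi i)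
      have : jm i ≤ ⌊(i : ℝ) / μ⌋₊ := Nat.floor_mono (by
        have := hub1 i
        linarith)
      have h3 : (jm i : ℝ) ≤ (i : ℝ) / μ :=
        (Nat.cast_le.2 this).trans (Nat.floor_le (by positivity))
      have := hub1 i
      linarith
    have h3 := (measureReal_mono (hB2 i)).trans (htail i (jm i) h2)
    linarith
  · simp only [Set.mem_union, Set.mem_ofPred_eq, not_or, not_le, not_lt] at hτ
    have h1 : (immigrants τ i : ℝ) < jp i := by exact_mod_cast immigrants_lt hτ.1
    have h2 : (jm i : ℝ) ≤ immigrants τ i := by exact_mod_cast le_immigrants hτ.1 hτ.2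
    have h3 := hjp2 i
    have h4 := hjm1 i
    have h5 := hub1 i
    rw [abs_le]
    constructor <;> linarith

/-- Since α/(i+1) is the inverse of (i+1)(1 + 1/μ), which differs from N_i by O((i+1)^β), and both
exceed (i+1) or equal it at least, the inverses differ by O((i+1)^(β-2)). -/
theorem abs_inv_total_sub_le {b : ℕ} (hb : 0 < b) (w i : ℕ) {μ β : ℝ} (hμ : 0 < μ) (hβ0 : 0 ≤ β)
    {τ : ℕ → ℕ} (hτ : |(immigrants τ i : ℝ) - i / μ| ≤ 2 * ((i : ℝ) + 1) ^ β) :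
    |1 / (total b w τ i : ℝ) - μ / (μ + 1) / (i + 1)| ≤
      (b + w + 1 / μ + 3) * ((i : ℝ) + 1) ^ (β - 2) := by
  have hN := natCast_add_one_le_total hb w i τ
  have hN0 : (0 : ℝ) < total b w τ i := lt_of_lt_of_le (by positivity) hN
  have hu0 : (0 : ℝ) < (i : ℝ) + 1 := by positivity
  have hu1 : (1 : ℝ) ≤ (i : ℝ) + 1 := by
    have : (0 : ℝ) ≤ i := Nat.cast_nonneg i
    linarith
  have hub1 : 1 ≤ ((i : ℝ) + 1) ^ β := Real.one_le_rpow hu1 hβ0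
  have hNe : (total b w τ i : ℝ) = b + w + i + immigrants τ i := by simp [total]
  set R : ℝ := (immigrants τ i : ℝ)
  have h1 : 1 / (total b w τ i : ℝ) - μ / (μ + 1) / (i + 1) =
      ((1 + 1 / μ) - (b + w) - (R - i / μ)) /
        (total b w τ i * (((i : ℝ) + 1) * (1 + 1 / μ))) := by
    rw [eq_div_iff (by positivity), hNe]
    rw [hNe] at hN0
    field_simp
    ring
  have h2 : |(1 + 1 / μ) - (b + w) - (R - i / μ)| ≤
      (b + w + 1 / μ + 3) * ((i : ℝ) + 1) ^ β := by
    have h3 : |(1 + 1 / μ) - (b + w)| ≤ 1 + 1 / μ + (b + w) := by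
      have : 0 < 1 / μ := by positivity
      rw [abs_le]
      constructor <;> linarith [(Nat.cast_nonneg b : (0 : ℝ) ≤ b), (Nat.cast_nonneg w : (0 : ℝ) ≤ w)]
    have h4 : 1 + 1 / μ + (b + w) ≤ (1 + 1 / μ + (b + w)) * ((i : ℝ) + 1) ^ β :=
      le_mul_of_one_le_right (by positivity) hub1
    refine (abs_sub _ _).trans ?_
    linarith
  have h3 : ((i : ℝ) + 1) ^ 2 ≤ total b w τ i * (((i : ℝ) + 1) * (1 + 1 / μ)) := by
    have : 1 ≤ 1 + 1 / μ := by
      have : 0 < 1 / μ := by positivity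
      linarith
    have h4 : (i : ℝ) + 1 ≤ ((i : ℝ) + 1) * (1 + 1 / μ) := le_mul_of_one_le_right hu0.le this
    rw [sq]
    exact mul_le_mul hN h4 hu0.le hN0.le
  rw [h1, abs_div, abs_of_pos (a := (total b w τ i : ℝ) * _) (by positivity),
    Real.rpow_sub hu0, Real.rpow_two, mul_div_assoc']
  exact div_le_div₀ (by positivity) h2 (by positivity) h3

/-! ### Case (a): a finite moment -/

theorem summable_natCast_succ_rpow {s : ℝ} (hs : s < -1) :
    Summable fun i : ℕ => ((i : ℝ) + 1) ^ s := by
  have := (summable_nat_add_iff 1).2 (Real.summable_nat_rpow.2 hs)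
  exact_mod_cast this

theorem exists_tendsto_integral_growth_of_moment (π : Measure ℕ) [IsProbabilityMeasure π]
    {b : ℕ} (hb : 0 < b) (w k : ℕ) {p : ℝ} (hp : 2 ≤ p)
    (hπ : Integrable (fun j : ℕ => (j : ℝ) ^ p) π) {μ : ℝ} (hμ0 : 0 < μ)
    (hμ : ∫ j : ℕ, (j : ℝ) ∂π = μ) (hk : k / (μ + 1) < p / 2 - 1) :
    ∃ m : ℝ, 0 < m ∧ Tendsto (fun n : ℕ =>
      (∫ τ, growth b w k τ n ∂(Measure.infinitePi fun _ : ℕ => π)) /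
        (n : ℝ) ^ (k * (μ / (μ + 1)))) atTop (𝓝 m) := by
  set α := μ / (μ + 1) with hα
  set r := k * (1 - α) with hr
  have hα0 : 0 ≤ α := by positivity
  have hrk : r = k / (μ + 1) := by rw [hr, hα]; field_simp; ring
  have hr0 : 0 ≤ r := by rw [hrk]; positivity
  rw [← hrk] at hk
  -- With this δ the exponent r + p/2 - (1-δ)p equals -1 - (p/2-1-r)/2, which is below -1.
  set δ := (p / 2 - 1 - r) / (2 * p) with hδ
  have hp0 : 0 < p := by linarith
  have hδ0 : 0 < δ := div_pos (by linarith) (by linarith)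
  have hδp : δ * p = (p / 2 - 1 - r) / 2 := by rw [hδ]; field_simp
  have hδ1 : δ ≤ 1 := by
    rw [hδ, div_le_one (by positivity)]; linarith
  obtain ⟨B, C, hBm, hC0, hBC, hBτ⟩ := exists_measureReal_exceptional_le π hp hπ hμ0 hμ
    (β := 1 - δ) (by linarith) (by linarith)
  set Q := Measure.infinitePi fun _ : ℕ => π with hQ
  set c : ℕ → ℝ := fun i => (b + w + 1 / μ + 3) * ((i : ℝ) + 1) ^ (1 - δ - 2) with hc
  have hc0 : ∀ i, 0 ≤ c i := fun i => by positivity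
  have hcs : Summable c := (summable_natCast_succ_rpow (by linarith)).mul_left _
  have hgood : ∀ i, ∀ τ ∉ B i, |1 / (total b w τ i : ℝ) - α / (i + 1)| ≤ c i := fun i τ hτ =>
    abs_inv_total_sub_le hb w i hμ0 (by linarith) (hBτ i τ hτ)
  -- The total loss over exceptional indices. Its finite mean serves twice: it gives the majorant
  -- `G`, and, each nonzero term being at least 1, it leaves only finitely many exceptional indices
  -- almost surely.
  set F : (ℕ → ℕ) → ℝ≥0∞ := fun τ =>
    ∑' i : ℕ, (B i).indicator (fun _ => ENNReal.ofReal (((i : ℝ) + 1) ^ r)) τ with hF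
  have hFm : Measurable F := Measurable.tsum fun i => measurable_const.indicator (hBm i)
  have hFint : ∫⁻ τ, F τ ∂Q ≠ ∞ := by
    have h1 : ∫⁻ τ, F τ ∂Q ≤ ∑' i : ℕ,
        ENNReal.ofReal (C * ((i : ℝ) + 1) ^ (r + (p / 2 - (1 - δ) * p))) := by
      rw [hF, lintegral_tsum fun i => (measurable_const.indicator (hBm i)).aemeasurable]
      refine ENNReal.tsum_le_tsum fun i => ?_
      have hu0 : (0 : ℝ) < (i : ℝ) + 1 := by positivity
      rw [lintegral_indicator_const (hBm i), ← ofReal_measureReal,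
        ← ENNReal.ofReal_mul (by positivity)]
      refine ENNReal.ofReal_le_ofReal ?_
      rw [Real.rpow_add hu0]
      calc _ ≤ ((i : ℝ) + 1) ^ r * (C * ((i : ℝ) + 1) ^ (p / 2 - (1 - δ) * p)) := by
            gcongr; exact hBC i
        _ = _ := by ring
    refine ne_top_of_le_ne_top ?_ h1
    refine Summable.tsum_ofReal_ne_top ?_
    exact (summable_natCast_succ_rpow (by nlinarith)).mul_left C
  have hFfin : ∀ᵐ τ ∂Q, F τ < ∞ := ae_lt_top hFm hFint
  have hFsum : ∀ τ, F τ < ∞ → ∀ n : ℕ, ∑ i ∈ Finset.range n,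
      {i | τ ∈ B i}.indicator (fun i : ℕ => ((i : ℝ) + 1) ^ r) i ≤ (F τ).toReal := by
    intro τ hτ n
    have h1 : ∀ i, {i | τ ∈ B i}.indicator (fun i : ℕ => ((i : ℝ) + 1) ^ r) i =
        ((B i).indicator (fun _ => ENNReal.ofReal (((i : ℝ) + 1) ^ r)) τ).toReal := by
      intro i
      by_cases h : τ ∈ B i
      · rw [Set.indicator_of_mem h, Set.indicator_of_mem (by exact h),
          ENNReal.toReal_ofReal (by positivity)]
      · rw [Set.indicator_of_notMem h, Set.indicator_of_notMem (by exact h), ENNReal.toReal_zero]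
    simp_rw [h1]
    rw [← ENNReal.toReal_sum fun i _ => ?_]
    · exact ENNReal.toReal_mono hτ.ne (ENNReal.sum_le_tsum _)
    · exact ((ENNReal.le_tsum i).trans_lt hτ).ne
  have hsum : ∀ᵐ τ ∂Q, Summable fun i : ℕ => |1 / (total b w τ i : ℝ) - α / (i + 1)| := by
    filter_upwards [hFfin] with τ hτ
    have hfin : {i | τ ∈ B i}.Finite := by
      have h1 : {i | τ ∈ B i} ⊆ {i | 1 ≤ (B i).indicator
          (fun _ => ENNReal.ofReal (((i : ℝ) + 1) ^ r)) τ} := by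
        intro i hi
        simp only [Set.mem_ofPred_eq] at hi ⊢
        rw [Set.indicator_of_mem hi]
        rw [ENNReal.one_le_ofReal]
        refine Real.one_le_rpow ?_ hr0
        have : (0 : ℝ) ≤ i := Nat.cast_nonneg i
        linarith
      exact (ENNReal.finite_const_le_of_tsum_ne_top hτ.ne one_ne_zero).subset h1
    refine Summable.of_norm_bounded_eventually hcs ?_
    rw [Filter.eventually_cofinite]
    refine hfin.subset fun i hi => ?_
    by_contra h
    refine hi ?_
    rw [Real.norm_eq_abs, abs_abs]
    exact hgood i τ h
  refine exists_tendsto_integral_prod_div_rpow Q k α (N := fun i τ => (total b w τ i : ℝ))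
    (fun i => measurable_total b w i) (fun i τ => natCast_add_one_le_total hb w i τ) hsum
    (G := fun τ => Real.exp (k * α) * Real.exp (k * ∑' i, c i) *
      (1 + Real.exp r * (F τ).toReal)) ?_ ?_
  · exact ((integrable_const (1 : ℝ)).add
      ((integrable_toReal_of_lintegral_ne_top hFm.aemeasurable hFint).const_mul _)).const_mul _
  · filter_upwards [hFfin] with τ hτ n hn
    refine (prod_le_of_exceptional k (α := α) (c := c)
      (fun i => natCast_add_one_le_total hb w i τ) {i | τ ∈ B i} hc0 (fun i hi => ?_) n).trans ?_
    · have := (abs_le.1 (hgood i τ hi)).2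
      linarith
    · rw [Real.exp_add]
      have h1 := exp_mul_harmonic_le (c := k * α) (by positivity) hn
      have h2 : Real.exp (k * ∑ i ∈ Finset.range n, c i) ≤ Real.exp (k * ∑' i, c i) := by
        gcongr
        exact hcs.sum_le_tsum _ fun i _ => hc0 i
      have h3 : ∑ i ∈ Finset.range n, {i | τ ∈ B i}.indicator
          (fun i => Real.exp (k * (1 - α) * harmonic (i + 1))) i ≤
          Real.exp r * (F τ).toReal := by
        refine le_trans ?_ (mul_le_mul_of_nonneg_left (hFsum τ hτ n) (Real.exp_pos r).le)
        rw [Finset.mul_sum]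
        refine Finset.sum_le_sum fun i _ => ?_
        by_cases h : i ∈ {i | τ ∈ B i}
        · rw [Set.indicator_of_mem h, Set.indicator_of_mem h]
          have := exp_mul_harmonic_le hr0 (Nat.succ_pos i)
          push_cast at this
          exact this
        · rw [Set.indicator_of_notMem h, Set.indicator_of_notMem h, mul_zero]
      have h4 : 0 ≤ ∑ i ∈ Finset.range n, {i | τ ∈ B i}.indicator
          (fun i => Real.exp (k * (1 - α) * harmonic (i + 1))) i :=
        Finset.sum_nonneg fun i _ => Set.indicator_nonneg (fun _ _ => (Real.exp_pos _).le) i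
      calc _ ≤ Real.exp (k * α) * (n : ℝ) ^ (k * α) * Real.exp (k * ∑' i, c i) *
            (1 + Real.exp r * (F τ).toReal) := by gcongr
        _ = _ := by ring

/-! ### Case (b): a heavy tail -/

/-- T_j ≤ i forces each of the j independent summands to be at most i. -/
theorem measure_arrivalTime_le (π : Measure ℕ) [IsProbabilityMeasure π] (i j : ℕ) :
    (Measure.infinitePi fun _ : ℕ => π) {τ | arrivalTime τ j ≤ i} ≤ π {x | x ≤ i} ^ j := by
  calc _ ≤ (Measure.infinitePi fun _ : ℕ => π)
        (Set.pi (Finset.range j) fun _ => {x | x ≤ i}) := by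
        refine measure_mono fun τ hτ m hm => ?_
        exact (Finset.single_le_sum (f := τ) (fun _ _ => Nat.zero_le _)
          (Finset.mem_coe.1 hm)).trans hτ
    _ = _ := by
        rw [Measure.infinitePi_pi _ fun _ _ => .of_discrete, Finset.prod_const, Finset.card_range]

/-- R_i is at most the number of j ≥ 1 with T_j ≤ i, whose mean is bounded by a geometric series of
ratio P(τ ≤ i). -/
theorem lintegral_immigrants_le (π : Measure ℕ) [IsProbabilityMeasure π] (i : ℕ) :
    ∫⁻ τ, (immigrants τ i : ℝ≥0∞) ∂(Measure.infinitePi fun _ : ℕ => π) ≤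
      (π {x | i < x})⁻¹ := by
  have hms : ∀ j, MeasurableSet {τ : ℕ → ℕ | arrivalTime τ j ≤ i} := fun j =>
    measurableSet_le (measurable_arrivalTime _) measurable_const
  have h1 : ∀ τ : ℕ → ℕ, (immigrants τ i : ℝ≥0∞) ≤
      ∑' j : ℕ, {τ | arrivalTime τ (j + 1) ≤ i}.indicator 1 τ := by
    intro τ
    calc (immigrants τ i : ℝ≥0∞) = ∑ j ∈ Finset.range (immigrants τ i), 1 := by simp
      _ = ∑ j ∈ Finset.range (immigrants τ i),
          {τ | arrivalTime τ (j + 1) ≤ i}.indicator 1 τ := by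
          refine Finset.sum_congr rfl fun j hj => ?_
          rw [Set.indicator_of_mem, Pi.one_apply]
          rw [Set.mem_ofPred_eq]
          by_contra! h
          have := immigrants_lt h
          rw [Finset.mem_range] at hj
          omega
      _ ≤ _ := ENNReal.sum_le_tsum _
  have h2 : 1 - π {x | x ≤ i} = π {x | i < x} := by
    rw [← prob_compl_eq_one_sub .of_discrete]
    congr 1
    ext x
    simp
  calc _ ≤ _ := lintegral_mono h1
    _ = ∑' j : ℕ, (Measure.infinitePi fun _ : ℕ => π) {τ | arrivalTime τ (j + 1) ≤ i} := by
        rw [lintegral_tsum fun j => (measurable_one.indicator (hms _)).aemeasurable]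
        exact tsum_congr fun j => lintegral_indicator_one (hms _)
    _ ≤ ∑' j : ℕ, π {x | x ≤ i} ^ j := by
        refine ENNReal.tsum_le_tsum fun j => (measure_arrivalTime_le π i (j + 1)).trans ?_
        exact pow_le_pow_of_le_one zero_le prob_le_one (Nat.le_succ j)
    _ = _ := by rw [ENNReal.tsum_geometric, h2]

theorem exists_tendsto_integral_growth_of_heavy_tail (π : Measure ℕ) [IsProbabilityMeasure π]
    {b : ℕ} (hb : 0 < b) (w k : ℕ) {ε C : ℝ} (hε : 0 < ε) (hC : 0 < C)
    (h : ∀ᶠ n : ℕ in atTop, C * (n : ℝ) ^ (-(1 - ε)) ≤ π.real {j | n < j}) :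
    ∃ m : ℝ, 0 < m ∧ Tendsto (fun n : ℕ =>
      (∫ τ, growth b w k τ n ∂(Measure.infinitePi fun _ : ℕ => π)) /
        (n : ℝ) ^ (k * (1 : ℝ))) atTop (𝓝 m) := by
  obtain ⟨i₀, hi₀⟩ := eventually_atTop.1 (h.and (eventually_gt_atTop 0))
  set Q := Measure.infinitePi fun _ : ℕ => π with hQ
  -- The shift by `i₀` drops the indices where the tail bound may fail. The mean of each term is
  -- O(i^(-2) · i^(1-ε)).
  set F : (ℕ → ℕ) → ℝ≥0∞ := fun τ =>
    ∑' i : ℕ, ENNReal.ofReal (1 / (((i + i₀ : ℕ) : ℝ) + 1) ^ 2) * immigrants τ (i + i₀) with hF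
  have hmi : ∀ i, Measurable fun τ : ℕ → ℕ => (immigrants τ i : ℝ≥0∞) := fun i =>
    (measurable_of_countable fun a : ℕ => (a : ℝ≥0∞)).comp (measurable_immigrants i)
  have hFm : Measurable F := Measurable.tsum fun i => (hmi _).const_mul _
  have hFint : ∫⁻ τ, F τ ∂Q ≠ ∞ := by
    have hle : ∫⁻ τ, F τ ∂Q ≤
        ∑' i : ℕ, ENNReal.ofReal (C⁻¹ * ((i + i₀ : ℕ) : ℝ) ^ (-1 - ε)) := by
      rw [hF, lintegral_tsum fun i => ((hmi _).const_mul _).aemeasurable]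
      refine ENNReal.tsum_le_tsum fun i => ?_
      rw [lintegral_const_mul _ (hmi _)]
      obtain ⟨h1, h2⟩ := hi₀ (i + i₀) (by omega)
      set u : ℝ := ((i + i₀ : ℕ) : ℝ) with hu
      have hu0 : 0 < u := by rw [hu]; exact_mod_cast h2
      have h3 : (π {x | i + i₀ < x})⁻¹ ≤ ENNReal.ofReal ((C * u ^ (-(1 - ε)))⁻¹) := by
        rw [ENNReal.ofReal_inv_of_pos (by positivity), ENNReal.inv_le_inv, ← ofReal_measureReal]
        exact ENNReal.ofReal_le_ofReal h1
      calc _ ≤ ENNReal.ofReal (1 / (u + 1) ^ 2) * ENNReal.ofReal ((C * u ^ (-(1 - ε)))⁻¹) := by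
            gcongr
            exact (lintegral_immigrants_le π _).trans h3
        _ ≤ _ := by
            rw [← ENNReal.ofReal_mul (by positivity)]
            refine ENNReal.ofReal_le_ofReal ?_
            have h4 : 1 / (u + 1) ^ 2 ≤ u ^ (-2 : ℝ) := by
              rw [Real.rpow_neg hu0.le, Real.rpow_two, ← one_div]
              gcongr
              linarith
            rw [mul_inv, ← Real.rpow_neg hu0.le, neg_neg]
            calc _ ≤ u ^ (-2 : ℝ) * (C⁻¹ * u ^ (1 - ε)) := by gcongr
              _ = C⁻¹ * (u ^ (-2 : ℝ) * u ^ (1 - ε)) := by ring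
              _ = _ := by rw [← Real.rpow_add hu0]; ring_nf
    refine ne_top_of_le_ne_top (Summable.tsum_ofReal_ne_top ?_) hle
    exact ((summable_nat_add_iff i₀).2
      (Real.summable_nat_rpow.2 (by linarith : -1 - ε < -1))).mul_left _
  have hsum : ∀ᵐ τ ∂Q, Summable fun i : ℕ => |1 / (total b w τ i : ℝ) - 1 / (i + 1)| := by
    filter_upwards [ae_lt_top hFm hFint] with τ hτ
    have h1 : Summable fun i : ℕ => 1 / ((i : ℝ) + 1) ^ 2 * (immigrants τ i : ℝ) := by
      refine (summable_nat_add_iff i₀).1 ((ENNReal.summable_toReal hτ.ne).congr fun i => ?_)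
      rw [ENNReal.toReal_mul, ENNReal.toReal_ofReal (by positivity), ENNReal.toReal_natCast]
    have h2 : Summable fun i : ℕ => 1 / ((i : ℝ) + 1) ^ 2 * ((b : ℝ) + w) := by
      refine Summable.mul_right _ ?_
      exact_mod_cast (summable_nat_add_iff 1).2 (Real.summable_one_div_nat_pow.2 one_lt_two)
    refine Summable.of_norm_bounded (h1.add h2) fun i => ?_
    have hN := natCast_add_one_le_total hb w i τ
    have hu0 : (0 : ℝ) < (i : ℝ) + 1 := by positivity
    have hN0 : (0 : ℝ) < total b w τ i := hu0.trans_le hN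
    have hNe : (total b w τ i : ℝ) = b + w + i + immigrants τ i := by simp [total]
    rw [Real.norm_eq_abs, abs_abs, abs_sub_comm, div_sub_div _ _ hu0.ne' hN0.ne', abs_div,
      abs_of_pos (mul_pos hu0 hN0), ← mul_add, one_div_mul_eq_div]
    refine div_le_div₀ (by positivity) ?_ (by positivity) ?_
    · rw [abs_le]
      constructor <;> linarith
    · rw [sq]; gcongr
  refine exists_tendsto_integral_prod_div_rpow Q k 1 (N := fun i τ => (total b w τ i : ℝ))
    (fun i => measurable_total b w i) (fun i τ => natCast_add_one_le_total hb w i τ) hsum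
    (G := fun _ => Real.exp k) (integrable_const _) (ae_of_all _ fun τ n hn => ?_)
  refine (prod_le_exp_harmonic k (fun i => natCast_add_one_le_total hb w i τ) n).trans ?_
  rw [mul_one]
  exact exp_mul_harmonic_le (Nat.cast_nonneg k) hn

/-- By Markov, n P(τ > n) is at most the mean, yet it is at least C n^ε. Hence the exponent is 1 in
case (b). -/
theorem mean_eq_top_of_heavy_tail (π : Measure ℕ) [IsProbabilityMeasure π] {ε C : ℝ} (hε : 0 < ε)
    (hC : 0 < C) (h : ∀ᶠ n : ℕ in atTop, C * (n : ℝ) ^ (-(1 - ε)) ≤ π.real {j | n < j}) :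
    mean π = ∞ := by
  by_contra hm
  have hb : ∀ᶠ n : ℕ in atTop, C * (n : ℝ) ^ ε ≤ (mean π).toReal := by
    filter_upwards [h, eventually_gt_atTop 0] with n h1 hn
    have hn' : (0 : ℝ) < n := by exact_mod_cast hn
    have h2 : (n : ℝ≥0∞) * π {j | n < j} ≤ mean π := by
      refine le_trans ?_ (mul_meas_ge_le_lintegral (μ := π)
        (measurable_of_countable fun j : ℕ => (j : ℝ≥0∞)) n)
      gcongr
      intro hj
      exact_mod_cast hj.le
    have h3 := ENNReal.toReal_mono hm h2
    rw [ENNReal.toReal_mul, ENNReal.toReal_natCast] at h3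
    refine le_trans ?_ h3
    have h4 := mul_le_mul_of_nonneg_left h1 hn'.le
    refine le_trans (le_of_eq ?_) h4
    have h5 : (n : ℝ) ^ ε = n * (n : ℝ) ^ (-(1 - ε)) := by
      rw [mul_comm, ← Real.rpow_add_one hn'.ne']; ring_nf
    rw [h5]; ring
  have ht : Tendsto (fun n : ℕ => C * (n : ℝ) ^ ε) atTop atTop :=
    ((tendsto_rpow_atTop hε).comp tendsto_natCast_atTop_atTop).const_mul_atTop hC
  obtain ⟨n, h1, h2⟩ := (hb.and (ht.eventually_gt_atTop (mean π).toReal)).exists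
  linarith

/-! ### From rising factorial moments to moments -/

/-- Convergence of rising factorial moments implies convergence of moments. -/
theorem tendsto_integral_pow_urnLaw (π : Measure ℕ) [IsProbabilityMeasure π] {b w : ℕ}
    (hb : 0 < b) (hw : 0 < w) (k : ℕ) {α m m' : ℝ} (hα : 0 < α)
    (h : Tendsto (fun n : ℕ =>
      (∫ τ, growth b w (k + 1) τ n ∂(Measure.infinitePi fun _ : ℕ => π)) /
        (n : ℝ) ^ (((k + 1 : ℕ) : ℝ) * α)) atTop (𝓝 m))
    (h' : Tendsto (fun n : ℕ =>
      (∫ τ, growth b w k τ n ∂(Measure.infinitePi fun _ : ℕ => π)) /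
        (n : ℝ) ^ (k * α)) atTop (𝓝 m')) :
    Tendsto (fun n : ℕ => (∫ x : ℕ, (x : ℝ) ^ (k + 1) ∂urnLaw n π b w) /
      (n : ℝ) ^ (((k + 1 : ℕ) : ℝ) * α)) atTop (𝓝 (w.ascFactorial (k + 1) * m)) := by
  obtain ⟨C, hC⟩ := ascFactorial_le_pow_add k
  have hI := fun n => integrable_ascFactorial_urnLaw n π hb hw
  have hle : ∀ x : ℕ, (x : ℝ) ^ (k + 1) ≤ (x.ascFactorial (k + 1) : ℝ) := fun x => by
    exact_mod_cast pow_le_ascFactorial x (k + 1)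
  have hge : ∀ x : ℕ, (x.ascFactorial (k + 1) : ℝ) - C * (x.ascFactorial k : ℝ) ≤
      (x : ℝ) ^ (k + 1) := fun x => by
    have := hC x
    rw [sub_le_iff_le_add]
    exact_mod_cast this
  have hIp : ∀ n, Integrable (fun x : ℕ => (x : ℝ) ^ (k + 1)) (urnLaw n π b w) := fun n =>
    (hI n (k + 1)).1.mono' (measurable_of_countable _).aestronglyMeasurable
      (ae_of_all _ fun x => by
        rw [Real.norm_of_nonneg (by positivity)]
        exact hle x)
  have hup : ∀ n, ∫ x : ℕ, (x : ℝ) ^ (k + 1) ∂urnLaw n π b w ≤ w.ascFactorial (k + 1) *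
      ∫ τ, growth b w (k + 1) τ n ∂(Measure.infinitePi fun _ : ℕ => π) := fun n => by
    rw [← (hI n (k + 1)).2]
    exact integral_mono (hIp n) (hI n (k + 1)).1 hle
  have hlow : ∀ n, w.ascFactorial (k + 1) *
      (∫ τ, growth b w (k + 1) τ n ∂(Measure.infinitePi fun _ : ℕ => π)) -
      C * (w.ascFactorial k * ∫ τ, growth b w k τ n ∂(Measure.infinitePi fun _ : ℕ => π)) ≤
      ∫ x : ℕ, (x : ℝ) ^ (k + 1) ∂urnLaw n π b w := fun n => by
    rw [← (hI n (k + 1)).2, ← (hI n k).2, ← integral_const_mul,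
      ← integral_sub (hI n (k + 1)).1 ((hI n k).1.const_mul _)]
    exact integral_mono ((hI n (k + 1)).1.sub ((hI n k).1.const_mul _)) (hIp n) hge
  have hzero : Tendsto (fun n : ℕ => (n : ℝ) ^ (-α)) atTop (𝓝 0) :=
    (tendsto_rpow_neg_atTop hα).comp tendsto_natCast_atTop_atTop
  -- The correction of order k, divided by n^((k+1)α), is a convergent sequence times n^(-α), so
  -- both bounds share one limit.
  have hlim := (h.const_mul (w.ascFactorial (k + 1) : ℝ)).sub
    ((h'.const_mul (C * w.ascFactorial k : ℝ)).mul hzero)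
  rw [mul_zero, sub_zero] at hlim
  refine tendsto_of_tendsto_of_tendsto_of_le_of_le' hlim
    (h.const_mul (w.ascFactorial (k + 1) : ℝ)) ?_ ?_
  · filter_upwards [eventually_gt_atTop 0] with n hn
    have hn' : (0 : ℝ) < n := by exact_mod_cast hn
    have h1 : (n : ℝ) ^ (((k + 1 : ℕ) : ℝ) * α) = (n : ℝ) ^ (k * α) * (n : ℝ) ^ α := by
      rw [← Real.rpow_add hn']; push_cast; ring_nf
    have h2 := div_le_div_of_nonneg_right (hlow n)
      (by positivity : 0 ≤ (n : ℝ) ^ (((k + 1 : ℕ) : ℝ) * α))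
    refine le_trans (le_of_eq ?_) h2
    rw [Real.rpow_neg hn'.le, h1]
    field_simp
  · filter_upwards with n
    rw [← mul_div_assoc]
    exact div_le_div_of_nonneg_right (hup n) (by positivity)

theorem exponent_pos {μ : ℝ≥0∞} (hμ : 0 < μ) : 0 < exponent μ := by
  rw [exponent]
  split_ifs with h
  · exact one_pos
  · have := ENNReal.toReal_pos hμ.ne' h
    positivity

theorem exists_tendsto_integral_growth {b : ℕ} (hb : 0 < b) (w : ℕ)
    (π : Measure ℕ) [IsProbabilityMeasure π] (hπ : 0 < mean π) (k : ℕ)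
    (h : (∃ p : ℝ, 1 < p ∧ ∫⁻ j, (j : ℝ≥0∞) ^ p ∂π < ∞ ∧
            (k : ℝ) < (p / 2 - 1) * ((mean π).toReal + 1) - 1) ∨
         (∃ ε : ℝ, 0 < ε ∧ ∃ C : ℝ, 0 < C ∧
            ∀ᶠ n : ℕ in atTop, C * (n : ℝ) ^ (-(1 - ε)) ≤ π.real {j | n < j})) :
    ∃ m : ℝ, 0 < m ∧ Tendsto (fun n : ℕ =>
      (∫ τ, growth b w k τ n ∂(Measure.infinitePi fun _ : ℕ => π)) /
        (n : ℝ) ^ (k * exponent (mean π))) atTop (𝓝 m) := by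
  rcases h with ⟨p, hp1, hp, hk⟩ | ⟨ε, hε, C, hC, h⟩
  · have hk0 : (0 : ℝ) ≤ k := Nat.cast_nonneg k
    have hμ0 : 0 ≤ (mean π).toReal := ENNReal.toReal_nonneg
    -- For p < 2 the upper bound on k would be negative.
    have hp2 : 2 ≤ p := by
      by_contra! h
      nlinarith
    have hint := integrable_rpow_of_lintegral_lt_top (by linarith) hp
    have hfin : mean π < ∞ := by
      have h1 : ∫⁻ j : ℕ, (1 + (j : ℝ≥0∞) ^ p) ∂π < ∞ := by
        rw [lintegral_add_left measurable_const]
        simp [hp]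
      refine (lintegral_mono fun j => ?_).trans_lt h1
      rcases le_total (j : ℝ≥0∞) 1 with h | h
      · exact h.trans le_self_add
      · refine le_trans ?_ le_add_self
        simpa using ENNReal.rpow_le_rpow_of_exponent_le h hp1.le
    have hμ : ∫ j : ℕ, (j : ℝ) ∂π = (mean π).toReal := by
      rw [integral_eq_lintegral_of_nonneg_ae (ae_of_all _ fun j => Nat.cast_nonneg j)
        (measurable_of_countable _).aestronglyMeasurable, mean]
      simp_rw [ENNReal.ofReal_natCast]
    rw [exponent, if_neg hfin.ne]
    refine exists_tendsto_integral_growth_of_moment π hb w k hp2 hint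
      (ENNReal.toReal_pos hπ.ne' hfin.ne) hμ ?_
    rw [div_lt_iff₀ (by linarith)]
    linarith
  · rw [mean_eq_top_of_heavy_tail π hε hC h, exponent, if_pos rfl]
    exact exists_tendsto_integral_growth_of_heavy_tail π hb w k hε hC h

end ImmigrationUrn

theorem theorem1 (b w : ℕ) (hb : 0 < b) (hw : 0 < w)
    (π : Measure ℕ) [IsProbabilityMeasure π] (hπ : 0 < ImmigrationUrn.mean π)
    (k : ℕ) (hk : 1 ≤ k)
    (h : (∃ p : ℝ, 1 < p ∧ ∫⁻ j, (j : ℝ≥0∞) ^ p ∂π < ∞ ∧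
            (k : ℝ) < (p / 2 - 1) * ((ImmigrationUrn.mean π).toReal + 1) - 1) ∨
         (∃ ε : ℝ, 0 < ε ∧ ∃ C : ℝ, 0 < C ∧
            ∀ᶠ n : ℕ in atTop, C * (n : ℝ) ^ (-(1 - ε)) ≤ π.real {j | n < j})) :
    ∃ m : ℝ, 0 < m ∧
      ∀ (Ω : ℕ → Type*) [∀ n, MeasurableSpace (Ω n)] (P : ∀ n, Measure (Ω n))
        (X : ∀ n, Ω n → ℕ),
        (∀ n, HasLaw (X n) (ImmigrationUrn.urnLaw n π b w) (P n)) →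
        Tendsto
          (fun n : ℕ => ∫ ω, ((X n ω : ℝ) /
            (n : ℝ) ^ ImmigrationUrn.exponent (ImmigrationUrn.mean π)) ^ k ∂(P n))
          atTop (𝓝 m) := by
  obtain ⟨k, rfl⟩ : ∃ l, k = l + 1 := ⟨k - 1, by omega⟩
  obtain ⟨m, hm, hlim⟩ := ImmigrationUrn.exists_tendsto_integral_growth hb w π hπ (k + 1) h
  -- The order one below is needed for the comparison with powers; it may be 0, and the condition on
  -- the order passes to smaller values.
  obtain ⟨m', -, hlim'⟩ := ImmigrationUrn.exists_tendsto_integral_growth hb w π hπ k (h.imp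
    (fun ⟨p, h1, h2, h3⟩ => ⟨p, h1, h2, by push_cast at h3; linarith⟩) id)
  have ht := ImmigrationUrn.tendsto_integral_pow_urnLaw π hb hw k
    (ImmigrationUrn.exponent_pos hπ) hlim hlim'
  refine ⟨w.ascFactorial (k + 1) * m, ?_, fun Ω _ P X hX => ht.congr fun n => ?_⟩
  · have : 0 < w.ascFactorial (k + 1) := by
      obtain ⟨v, rfl⟩ : ∃ v, w = v + 1 := ⟨w - 1, by omega⟩
      exact Nat.ascFactorial_pos v (k + 1)
    positivity
  · have h1 := (hX n).integral_comp (f := fun x : ℕ => ((x : ℝ) /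
      (n : ℝ) ^ ImmigrationUrn.exponent (ImmigrationUrn.mean π)) ^ (k + 1))
      (measurable_of_countable _).aestronglyMeasurable
    refine Eq.trans ?_ h1.symm
    simp_rw [div_pow]
    rw [integral_div, ← Real.rpow_mul_natCast (Nat.cast_nonneg n), mul_comm]
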